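/- Let $K=3$, $M=2$, $N=3$. Consider the $K$-user MIMO X channel, in which each of the three transmitters has $M=2$ antennas, each of the three receivers has $N=3$ antennas, and transmitter $i$ has an independent message $W_{ij}$ for receiver $j$, for all $i,j\in\{1,2,3\}$ (nine messages). In channel use $t$, receiver $j$ observes $$\bar{\mathbf Y}^{[j]}(t)=\sum_{i=1}^{3}\mathbf H^{[ji]}\mathbf X^{[i]}(t)+\mathbf Z^{[j]}(t),$$ where $\mathbf X^{[i]}(t)\in\mathbb C^{2}$, the matrices $\mathbf H^{[ji]}\in\mathbb C^{3\times 2}$ are constant in $t$ and known to all nodes, and the entries of $\mathbf Z^{[j]}(t)$ are i.i.d. $\mathcal{CN}(0,1)$, also over $t$. Codes of length $n$ satisfy $\frac1n\sum_{t=1}^n\mathbb E\|\mathbf X^{[i]}(t)\|^2\le\rho$ for every $i$, and each receiver $j$ decodes $W_{1j},W_{2j},W_{3j}$ from its own observations with an error probability (for uniformly distributed messages) that tends to $0$ as $n\to\infty$. Let $R(\rho)$ be the symmetric capacity, i.e. the supremum of the rates $R$ that are achievable simultaneously by all nine messages, and let $$d=\limsup_{\rho\to\infty}\frac{R(\rho)}{\log\rho}$$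 be the symmetric degrees of freedom (DoF) per message (the limit, if it exists). If the $54$ complex channel coefficients are drawn independently from continuous (atomless) distributions, then almost surely $$d\le\frac{2N}{12}=\frac12=\frac{MN}{3M+2N}.$$ -/

import Mathlib

open MeasureTheory ProbabilityTheory Filter
open scoped ENNReal NNReal Topology

noncomputable section

/-- Channel matrices of the `K`-user MIMO X channel with `M` antennas at every transmitter and `N`
antennas at every receiver: `H j i` is the `N × M` matrix from transmitter `i` to receiver `j`,
constant over all channel uses. -/
abbrev XChannel (K M N : ℕ) : Type := Fin K → Fin K → Matrix (Fin N) (Fin M) ℂ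

/-- The circularly symmetric complex Gaussian law of mean zero and unit variance: independent real
and imaginary parts, each of variance `1 / 2`. -/
def stdComplexGaussian : Measure ℂ :=
  ((gaussianReal 0 (1 / 2)).prod (gaussianReal 0 (1 / 2))).map (fun p : ℝ × ℝ => Complex.mk p.1 p.2)

/-- The law of the noise at one receiver over `n` channel uses: independent standard complex
Gaussian entries over all channel uses and receive antennas. -/
def noiseLaw (n N : ℕ) : Measure (Fin n → Fin N → ℂ) :=
  Measure.pi fun _ => Measure.pi fun _ => stdComplexGaussian

/-- A block code of length `n`. Message `(i, j)` goes from transmitter `i` to receiver `j` and takes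
`size i j` values. Transmitter `i` encodes its own messages only, and receiver `j` estimates the
messages meant for it from its own received block. Codes may depend on the channel matrices, as they
are chosen after these (global channel knowledge). -/
structure XCode (K M N n : ℕ) where
  size : Fin K → Fin K → ℕ
  enc : ∀ i, (∀ j, Fin (size i j)) → Fin n → Fin M → ℂ
  dec : ∀ j, (Fin n → Fin N → ℂ) → ∀ i, Fin (size i j)
  measurable_dec : ∀ j, Measurable (dec j)

namespace XCode

variable {K M N n : ℕ}

/-- The tuples of all `K²` messages. -/
abbrev Msg (c : XCode K M N n) : Type := ∀ i j, Fin (c.size i j)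

/-- The average over uniformly distributed, independent messages. -/
def avg (c : XCode K M N n) (f : c.Msg → ℝ) : ℝ :=
  (∑ w, f w) / Fintype.card c.Msg

/-- The average transmit power `(1 / n) ∑ₜ 𝔼 ‖X⁽ⁱ⁾(t)‖²` of transmitter `i`. -/
def power (c : XCode K M N n) (i : Fin K) : ℝ :=
  (1 / n) * ∑ t, c.avg fun w => ∑ a, ‖c.enc i (w i) t a‖ ^ 2

/-- The block received by receiver `j` when the messages are `w` and its noise is `z`:
`Y⁽ʲ⁾(t) = ∑ᵢ H⁽ʲⁱ⁾ X⁽ⁱ⁾(t) + Z⁽ʲ⁾(t)`. -/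
def received (c : XCode K M N n) (H : XChannel K M N) (j : Fin K) (w : c.Msg)
    (z : Fin n → Fin N → ℂ) : Fin n → Fin N → ℂ :=
  fun t => (∑ i, (H j i).mulVec (c.enc i (w i) t)) + z t

/-- The probability that receiver `j` gets one of its `K` desired messages wrong, for uniformly
distributed, independent messages. -/
def errorProb (c : XCode K M N n) (H : XChannel K M N) (j : Fin K) : ℝ :=
  c.avg fun w => (noiseLaw n N).real {z | c.dec j (c.received H j w z) ≠ fun i => w i j}

end XCode

variable {K M N : ℕ}

/-- All `K²` messages can simultaneously be sent reliably at rate `R` (in nats per channel use)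
under the power constraint `ρ` at every transmitter. -/
def SymAchievable (H : XChannel K M N) (ρ : ℝ) (R : ℝ) : Prop :=
  ∀ ε > 0, ∀ᶠ n : ℕ in atTop, ∃ c : XCode K M N n,
    (∀ i, c.power i ≤ ρ) ∧
    (∀ i j, Real.exp (n * R) ≤ c.size i j) ∧
    ∀ j, c.errorProb H j ≤ ε

/-- The symmetric capacity: the highest rate simultaneously achievable by every message. -/
def symCapacity (H : XChannel K M N) (ρ : ℝ) : ℝ≥0∞ :=
  ⨆ (R : ℝ≥0) (_ : SymAchievable H ρ R), (R : ℝ≥0∞)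

/-- The symmetric DoF per message, the limit of `symCapacity H ρ / log ρ` as `ρ → ∞`. It is taken as
an upper limit, which is the limit whenever that exists, so an upper bound on it is the stronger
one. -/
def symDoF (H : XChannel K M N) : ℝ≥0∞ :=
  limsup (fun ρ : ℝ => symCapacity H ρ / ENNReal.ofReal (Real.log ρ)) atTop

/-- The `K · K · N · M` channel coefficients are independent complex random variables with
continuous distributions. Only the absence of atoms is asked for, so that distributions with a
density are included. -/
structure IndepContinuous {Ω : Type*} [MeasurableSpace Ω] (P : Measure Ω)
    (H : Ω → XChannel K M N) : Prop where
  measurable : ∀ j i r a, Measurable fun ω => H ω j i r a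
  indep : iIndepFun
    (fun (q : Fin K × Fin K × Fin N × Fin M) (ω : Ω) => H ω q.1 q.2.1 q.2.2.1 q.2.2.2) P
  continuous : ∀ j i r a (x : ℂ), P {ω | H ω j i r a = x} = 0

end

/-! The bound is `6 R ≤ 3 log (1 + ρ) + O(1)`. Receiver `0` has three antennas, hence about `3 log
ρ` of signal space. Its own three messages take `3 R` of it, and the interference is shown to take
at least another `3 R`.

In entropy terms, let `A`, `B`, `C` be the messages of transmitters `0`, `1`, `2` for the other two
receivers, `2 R` each. With `C` known, nulling transmitter `1` by a row `U` reveals the projection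
`U H₀₀ X₀`, so the interference has entropy at least that of this projection plus that of `B`. With
`B` known, a row `W` nulling transmitter `2` gives the same for `W H₀₀ X₀` and `C`. The two
projections together determine `X₀`, so twice the interference is at least `H(A) + H(B) + H(C) = 6
R`.

The proof replaces entropy by counting at noise resolution: two signals are near if their squared
distance is at most `48 n`, and factors `exp (O(n))`, with constants depending on the channel but
not on `ρ`, are harmless. `exists_separated_triples` is the counting form of the entropy inequality.
Codewords can stand for messages because receivers `1` and `2` decode: few good messages have
codewords in one small ball (`XCode.card_side_le`). The upper bound is a Gaussian packing estimate,
`card_mul_le_of_disjoint`, used by `XCode.card_le_of_signals_separated`.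
`ZeroForcing.rate_le_of_code` combines these for a single code.

The matrices needed exist once one polynomial in the channel coefficients is nonzero, and a nonzero
polynomial vanishes with probability zero under independent atomless laws. -/

noncomputable section

/-! ### Gaussian noise: densities, packing and tails -/

/-- The squared Euclidean norm of a block. -/
def blockSq {n N : ℕ} (x : Fin n → Fin N → ℂ) : ℝ := ∑ t, ∑ a, ‖x t a‖ ^ 2

/-- The density of the noise at one receiver. -/
def noiseDensity {n N : ℕ} (x : Fin n → Fin N → ℂ) : ℝ :=
  (Real.pi⁻¹ ^ N) ^ n * Real.exp (-blockSq x)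

theorem pi_withDensity_ofReal {ι α : Type*} [Fintype ι] [MeasurableSpace α] (μ : Measure α)
    [SigmaFinite μ] (f : α → ℝ) (hf : Integrable f μ) (h0 : ∀ x, 0 ≤ f x) :
    Measure.pi (fun _ : ι => μ.withDensity fun x => ENNReal.ofReal (f x)) =
      (Measure.pi fun _ : ι => μ).withDensity fun x => ENNReal.ofReal (∏ i, f (x i)) := by
  have : IsFiniteMeasure (μ.withDensity fun x => ENNReal.ofReal (f x)) :=
    isFiniteMeasure_withDensity_ofReal hf.2
  refine Measure.pi_eq fun s hs => ?_
  rw [withDensity_apply _ (MeasurableSet.univ_pi hs), ← ofReal_integral_eq_lintegral_ofReal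
    (Integrable.fintype_prod fun _ => hf).integrableOn
    (Eventually.of_forall fun x => Finset.prod_nonneg fun i _ => h0 _)]
  have h1 : ∀ i, (μ.withDensity fun x => ENNReal.ofReal (f x)) (s i)
      = ENNReal.ofReal (∫ x, (s i).indicator f x ∂μ) := fun i => by
    rw [withDensity_apply _ (hs i), integral_indicator (hs i),
      ofReal_integral_eq_lintegral_ofReal hf.integrableOn (Eventually.of_forall h0)]
  simp_rw [h1]
  rw [← ENNReal.ofReal_prod_of_nonneg
    (fun i _ => integral_nonneg fun x => Set.indicator_nonneg (fun x _ => h0 x) x),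
    ← integral_fintype_prod_eq_prod, ← integral_indicator (MeasurableSet.univ_pi hs)]
  congr 1
  refine integral_congr_ae (Eventually.of_forall fun x => ?_)
  by_cases hx : x ∈ Set.univ.pi s
  · simp only [Set.indicator_of_mem hx]
    exact Finset.prod_congr rfl fun i _ => (Set.indicator_of_mem (hx i trivial) f).symm
  · simp only [Set.indicator_of_notMem hx]
    obtain ⟨i, hi⟩ : ∃ i, x i ∉ s i := by simpa [Set.mem_pi] using hx
    exact (Finset.prod_eq_zero (Finset.mem_univ i) (Set.indicator_of_notMem hi f)).symm

theorem gaussianReal_half_pdf (x : ℝ) :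
    gaussianPDFReal 0 (1 / 2) x = (√Real.pi)⁻¹ * Real.exp (-x ^ 2) := by
  have h2 : √2 ≠ 0 := by positivity
  simp [gaussianPDFReal]
  field_simp

theorem stdComplexGaussian_eq_withDensity :
    stdComplexGaussian = volume.withDensity
      fun z : ℂ => ENNReal.ofReal (Real.pi⁻¹ * Real.exp (-‖z‖ ^ 2)) := by
  have hm : Measurable fun z : ℂ => ENNReal.ofReal (Real.pi⁻¹ * Real.exp (-‖z‖ ^ 2)) := by
    fun_prop
  have he := Complex.volume_preserving_equiv_real_prod.symm
  have hfun : (fun p : ℝ × ℝ => Complex.mk p.1 p.2) = Complex.measurableEquivRealProd.symm := rfl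
  rw [stdComplexGaussian, gaussianReal_of_var_ne_zero _ (by norm_num),
    prod_withDensity (measurable_gaussianPDF _ _) (measurable_gaussianPDF _ _), hfun]
  ext s hs
  rw [Measure.map_apply Complex.measurableEquivRealProd.symm.measurable hs,
    withDensity_apply _ hs, withDensity_apply _ (Complex.measurableEquivRealProd.symm.measurable hs),
    ← he.setLIntegral_comp_preimage hs hm]
  refine lintegral_congr fun p => ?_
  rw [gaussianPDF, gaussianPDF, ← ENNReal.ofReal_mul (gaussianPDFReal_nonneg _ _ _),
    gaussianReal_half_pdf, gaussianReal_half_pdf]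
  congr 1
  have : ‖Complex.measurableEquivRealProd.symm p‖ ^ 2 = p.1 ^ 2 + p.2 ^ 2 := by
    rw [← Complex.normSq_eq_norm_sq, Complex.normSq_apply, ← hfun]; ring
  rw [this, neg_add, Real.exp_add]
  have hpi : (√Real.pi)⁻¹ * (√Real.pi)⁻¹ = Real.pi⁻¹ := by
    rw [← mul_inv, Real.mul_self_sqrt Real.pi_pos.le]
  rw [← hpi]; ring

instance : IsProbabilityMeasure stdComplexGaussian :=
  Measure.isProbabilityMeasure_map (by
    exact Complex.measurableEquivRealProd.symm.measurable.aemeasurable)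

instance (n N : ℕ) : IsProbabilityMeasure (noiseLaw n N) := by
  unfold noiseLaw; infer_instance

theorem integrable_of_withDensity_ofReal {α : Type*} [MeasurableSpace α] {μ : Measure α}
    {f : α → ℝ} (hf : AEStronglyMeasurable f μ) (h0 : ∀ x, 0 ≤ f x)
    (h : IsFiniteMeasure (μ.withDensity fun x => ENNReal.ofReal (f x))) : Integrable f μ := by
  refine ⟨hf, ?_⟩
  rw [hasFiniteIntegral_iff_ofReal (Eventually.of_forall h0)]
  have := h.measure_univ_lt_top
  rwa [withDensity_apply _ MeasurableSet.univ, Measure.restrict_univ] at this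

theorem noiseLaw_eq_withDensity (n N : ℕ) :
    noiseLaw n N = volume.withDensity fun x => ENNReal.ofReal (noiseDensity x) := by
  have hint : Integrable fun z : ℂ => Real.pi⁻¹ * Real.exp (-‖z‖ ^ 2) :=
    integrable_of_withDensity_ofReal (by fun_prop) (fun z => by positivity)
      (stdComplexGaussian_eq_withDensity ▸ inferInstance)
  have h1 := pi_withDensity_ofReal (ι := Fin N) volume _ hint fun z => by positivity
  rw [← stdComplexGaussian_eq_withDensity] at h1
  have h2 := pi_withDensity_ofReal (ι := Fin n) (Measure.pi fun _ : Fin N => volume)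
    (fun x : Fin N → ℂ => ∏ a, Real.pi⁻¹ * Real.exp (-‖x a‖ ^ 2))
    (Integrable.fintype_prod fun _ => hint) fun x => Finset.prod_nonneg fun i _ => by positivity
  rw [← h1] at h2
  rw [noiseLaw, h2]
  congr 1
  ext x
  congr 1
  simp only [Finset.prod_mul_distrib, Finset.prod_const, Finset.card_univ, Fintype.card_fin,
    noiseDensity, blockSq, ← Real.exp_sum, Finset.sum_neg_distrib]

theorem measurable_blockSq {n N : ℕ} : Measurable (blockSq (n := n) (N := N)) := by
  unfold blockSq; fun_prop

theorem measurable_noiseDensity {n N : ℕ} : Measurable (noiseDensity (n := n) (N := N)) :=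
  (Real.measurable_exp.comp measurable_blockSq.neg).const_mul _

theorem noiseDensity_nonneg {n N : ℕ} (x : Fin n → Fin N → ℂ) : 0 ≤ noiseDensity x := by
  have := Real.pi_pos
  unfold noiseDensity; positivity

theorem blockSq_nonneg {n N : ℕ} (x : Fin n → Fin N → ℂ) : 0 ≤ blockSq x := by
  unfold blockSq; positivity

theorem blockSq_smul {n N : ℕ} (r : ℝ) (x : Fin n → Fin N → ℂ) :
    blockSq (r • x) = r ^ 2 * blockSq x := by
  simp [blockSq, mul_pow, Finset.mul_sum]

theorem blockSq_neg {n N : ℕ} (x : Fin n → Fin N → ℂ) : blockSq (-x) = blockSq x := by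
  simp [blockSq]

theorem blockSq_sub_comm {n N : ℕ} (x y : Fin n → Fin N → ℂ) :
    blockSq (x - y) = blockSq (y - x) := by
  rw [← blockSq_neg, neg_sub]

theorem blockSq_add_le {n N : ℕ} {τ : ℝ} (hτ : 0 < τ) (x y : Fin n → Fin N → ℂ) :
    blockSq (x + y) ≤ (1 + τ) * blockSq x + (1 + τ⁻¹) * blockSq y := by
  simp only [blockSq, Finset.mul_sum, ← Finset.sum_add_distrib]
  refine Finset.sum_le_sum fun t _ => Finset.sum_le_sum fun a _ => ?_
  have h := norm_add_le (x t a) (y t a)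
  have h2 : ‖x t a + y t a‖ ^ 2 ≤ (‖x t a‖ + ‖y t a‖) ^ 2 := by gcongr
  have hi : τ * τ⁻¹ = 1 := mul_inv_cancel₀ hτ.ne'
  have h3 : 0 ≤ τ⁻¹ * (τ * ‖x t a‖ - ‖y t a‖) ^ 2 := by positivity
  have h4 : τ⁻¹ * (τ * ‖x t a‖ - ‖y t a‖) ^ 2
      = (τ * τ⁻¹) * (τ * ‖x t a‖ ^ 2 - 2 * ‖x t a‖ * ‖y t a‖) + τ⁻¹ * ‖y t a‖ ^ 2 := by ring
  rw [h4, hi] at h3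
  simp only [Pi.add_apply]
  nlinarith

theorem blockSq_sub_le {n N : ℕ} (x y z : Fin n → Fin N → ℂ) :
    blockSq (x - z) ≤ 2 * blockSq (x - y) + 2 * blockSq (y - z) := by
  have := blockSq_add_le one_pos (x - y) (y - z)
  rw [sub_add_sub_cancel] at this
  norm_num at this
  exact this

theorem lintegral_noiseDensity (n N : ℕ) :
    ∫⁻ x : Fin n → Fin N → ℂ, ENNReal.ofReal (noiseDensity x) = 1 := by
  have := measure_univ (μ := noiseLaw n N)
  rwa [noiseLaw_eq_withDensity, withDensity_apply _ MeasurableSet.univ,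
    Measure.restrict_univ] at this

/-- The blocks have real dimension `2 n N`, so stretching by `√τ` multiplies volume by `τ ^ (n N)`.
-/
theorem lintegral_noiseDensity_smul (n N : ℕ) {τ : ℝ} (hτ : 0 < τ) :
    ∫⁻ x : Fin n → Fin N → ℂ, ENNReal.ofReal (noiseDensity ((√τ)⁻¹ • x)) =
      ENNReal.ofReal (τ ^ (n * N)) := by
  have hs : 0 < √τ := Real.sqrt_pos.2 hτ
  have h := lintegral_map (μ := (volume : Measure (Fin n → Fin N → ℂ)))
    (g := fun x => (√τ)⁻¹ • x) (measurable_noiseDensity.ennreal_ofReal)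
    (measurable_const_smul _)
  have : (volume : Measure (Fin n → Fin N → ℂ)).IsAddHaarMeasure :=
    Measure.pi.isAddHaarMeasure _
  rw [← h, Measure.map_addHaar_smul _ (inv_ne_zero hs.ne'), lintegral_smul_measure,
    lintegral_noiseDensity, smul_eq_mul, mul_one]
  congr 1
  simp only [Module.finrank_pi_fintype, Complex.finrank_real_complex, Finset.sum_const,
    Finset.card_univ, Fintype.card_fin, smul_eq_mul]
  rw [← inv_pow, inv_inv, abs_of_pos (by positivity), ← mul_assoc, mul_comm (n * N) 2, pow_mul,
    Real.sq_sqrt hτ.le]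

/-- The triangle inequality with weight `τ`, divided by `1 + τ`. One wide Gaussian thus dominates
the noise densities about all centres `s` in a ball, at a cost depending only on the radius. -/
theorem noiseDensity_sub_le {n N : ℕ} {τ : ℝ} (hτ : 0 < τ) (y s : Fin n → Fin N → ℂ) :
    noiseDensity (y - s) ≤ Real.exp (blockSq s / τ) * noiseDensity ((√(1 + τ))⁻¹ • y) := by
  have h := blockSq_add_le hτ (y - s) s
  rw [sub_add_cancel] at h
  have hpi := Real.pi_pos
  rw [noiseDensity, noiseDensity, mul_left_comm, ← Real.exp_add, blockSq_smul, inv_pow (√(1 + τ)),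
    Real.sq_sqrt (by positivity)]
  gcongr
  have h1 : (1 + τ)⁻¹ * blockSq y ≤ blockSq (y - s) + blockSq s / τ := by
    rw [inv_mul_le_iff₀ (by positivity)]
    calc _ ≤ _ := h
      _ = _ := by field_simp; ring
  linarith

theorem noiseLaw_shift_apply {n N : ℕ} (s : Fin n → Fin N → ℂ) {E : Set (Fin n → Fin N → ℂ)}
    (hE : MeasurableSet E) :
    noiseLaw n N {z | s + z ∈ E} = ∫⁻ y in E, ENNReal.ofReal (noiseDensity (y - s)) := by
  have hm : MeasurableSet {z | s + z ∈ E} := (measurable_const_add s) hE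
  rw [noiseLaw_eq_withDensity, withDensity_apply _ hm, ← lintegral_indicator hm,
    ← lintegral_indicator hE,
    ← lintegral_add_left_eq_self (E.indicator _) s]
  refine lintegral_congr fun z => ?_
  by_cases h : s + z ∈ E
  · rw [Set.indicator_of_mem h, Set.indicator_of_mem (show z ∈ {z | s + z ∈ E} from h),
      add_sub_cancel_left]
  · rw [Set.indicator_of_notMem h, Set.indicator_of_notMem (show z ∉ {z | s + z ∈ E} from h)]

/-- Each set has mass at least `p` under its shifted noise, and all these laws lie below a common
multiple of one wide Gaussian. As the sets are disjoint, the total mass of the latter bounds the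
sum. It is used with `τ = 1` for balls of squared radius `O(n)` and with `τ = ρ` for radius `O(n
ρ)`. -/
theorem card_mul_le_of_disjoint {n N : ℕ} {ι : Type*} (T : Finset ι)
    (s : ι → Fin n → Fin N → ℂ) (c : Fin n → Fin N → ℂ) (E : ι → Set (Fin n → Fin N → ℂ))
    (hE : ∀ i ∈ T, MeasurableSet (E i)) (hd : (T : Set ι).PairwiseDisjoint E) {p B τ : ℝ}
    (hτ : 0 < τ) (hB : ∀ i ∈ T, blockSq (s i - c) ≤ B)
    (hp : ∀ i ∈ T, p ≤ (noiseLaw n N).real {z | s i + z ∈ E i}) :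
    T.card * p ≤ Real.exp (B / τ) * (1 + τ) ^ (n * N) := by
  have key : ∀ i ∈ T, noiseLaw n N {z | s i + z ∈ E i} ≤
      ∫⁻ y in E i, ENNReal.ofReal (Real.exp (B / τ)) *
        ENNReal.ofReal (noiseDensity ((√(1 + τ))⁻¹ • (y - c))) := fun i hi => by
    rw [noiseLaw_shift_apply _ (hE i hi)]
    refine lintegral_mono fun y => ?_
    rw [← ENNReal.ofReal_mul (Real.exp_pos _).le]
    refine ENNReal.ofReal_le_ofReal ?_
    have h := noiseDensity_sub_le hτ (y - c) (s i - c)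
    rw [sub_sub_sub_cancel_right] at h
    refine h.trans ?_
    gcongr
    · exact noiseDensity_nonneg _
    · exact hB i hi
  have hsum : ∑ i ∈ T, noiseLaw n N {z | s i + z ∈ E i} ≤
      ENNReal.ofReal (Real.exp (B / τ) * (1 + τ) ^ (n * N)) := by
    refine (Finset.sum_le_sum key).trans ?_
    rw [← lintegral_biUnion_finset hd hE]
    refine (setLIntegral_le_lintegral _ _).trans ?_
    have hm : Measurable fun y : Fin n → Fin N → ℂ =>
        ENNReal.ofReal (noiseDensity ((√(1 + τ))⁻¹ • (y - c))) :=
      (measurable_noiseDensity.comp (by fun_prop)).ennreal_ofReal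
    rw [lintegral_const_mul _ hm, lintegral_sub_right_eq_self
      (fun y => ENNReal.ofReal (noiseDensity ((√(1 + τ))⁻¹ • y))) c,
      lintegral_noiseDensity_smul n N (by positivity), ← ENNReal.ofReal_mul (Real.exp_pos _).le]
  have h2 : (T.card : ℝ) * p ≤ ∑ i ∈ T, (noiseLaw n N).real {z | s i + z ∈ E i} := by
    rw [← nsmul_eq_mul]
    exact Finset.card_nsmul_le_sum _ _ _ hp
  refine h2.trans ?_
  simp only [Measure.real]
  rw [← ENNReal.toReal_sum (fun i _ => measure_ne_top _ _)]
  exact ENNReal.toReal_le_of_le_ofReal (by positivity) hsum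

/-- A Chernoff bound: in the tail, half of the exponent is at least `6 n`, and the other half
integrates to `8 ^ n` relative to the noise. Finally `8 exp (-6) ≤ 1 / 4`. -/
theorem noiseLaw_blockSq_gt_le {n : ℕ} (hn : n ≠ 0) :
    (noiseLaw n 3).real {z | 12 * (n : ℝ) < blockSq z} ≤ 1 / 4 := by
  have hm : MeasurableSet {z : Fin n → Fin 3 → ℂ | 12 * (n : ℝ) < blockSq z} :=
    measurableSet_lt measurable_const measurable_blockSq
  have hm2 : Measurable fun z : Fin n → Fin 3 → ℂ =>
      ENNReal.ofReal (noiseDensity ((√2)⁻¹ • z)) :=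
    (measurable_noiseDensity.comp (measurable_const_smul _)).ennreal_ofReal
  have h : noiseLaw n 3 {z | 12 * (n : ℝ) < blockSq z} ≤
      ENNReal.ofReal (Real.exp (-(6 * n)) * 2 ^ (n * 3)) := by
    rw [noiseLaw_eq_withDensity, withDensity_apply _ hm,
      ENNReal.ofReal_mul (Real.exp_pos _).le, ← lintegral_noiseDensity_smul n 3 two_pos,
      ← lintegral_const_mul _ hm2]
    refine le_trans ?_ (setLIntegral_le_lintegral {z | 12 * (n : ℝ) < blockSq z} _)
    refine setLIntegral_mono' hm fun z hz => ?_
    rw [← ENNReal.ofReal_mul (Real.exp_pos _).le]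
    refine ENNReal.ofReal_le_ofReal ?_
    have hpi := Real.pi_pos
    rw [noiseDensity, noiseDensity, mul_left_comm, ← Real.exp_add, blockSq_smul, inv_pow (√2),
      Real.sq_sqrt (by positivity)]
    gcongr
    have : 12 * (n : ℝ) < blockSq z := hz
    linarith
  refine (ENNReal.toReal_le_of_le_ofReal (by positivity) h).trans ?_
  have h1 : Real.exp (-(6 * n)) * 2 ^ (n * 3) = (Real.exp (-6) * 8) ^ n := by
    rw [mul_comm n 3, pow_mul, mul_pow, ← Real.exp_nat_mul]; norm_num; ring_nf
  have h2 : Real.exp (-6) * 8 ≤ 1 / 4 := by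
    have h3 : (2 : ℝ) ^ 6 ≤ Real.exp 6 := by
      rw [show (6 : ℝ) = (6 : ℕ) * 1 by norm_num, Real.exp_nat_mul]
      gcongr
      linarith [Real.add_one_le_exp (1 : ℝ)]
    rw [Real.exp_neg, inv_mul_le_iff₀ (Real.exp_pos _)]
    norm_num at h3
    linarith
  rw [h1]
  exact (pow_le_of_le_one (by positivity) (h2.trans (by norm_num)) hn).trans h2

/-! ### Counting separated families -/

section Combinatorics
open Classical in
-- A maximal separated subset is a net. Transitivity is not available, since nearness is a distance
-- bound.
theorem exists_separated_dominating {α : Type*} (r : α → α → Prop) (hr : ∀ a, r a a)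
    (hs : ∀ a b, r a b → r b a) (S : Finset α) :
    ∃ T ⊆ S, (∀ a ∈ T, ∀ b ∈ T, a ≠ b → ¬ r a b) ∧ ∀ a ∈ S, ∃ t ∈ T, r a t := by
  induction S using Finset.induction_on with
  | empty => exact ⟨∅, by simp⟩
  | insert x S hx ih =>
    obtain ⟨T, hTS, hsep, hdom⟩ := ih
    by_cases h : ∃ t ∈ T, r x t
    · refine ⟨T, hTS.trans (Finset.subset_insert _ _), hsep, fun a ha => ?_⟩
      rcases Finset.mem_insert.1 ha with rfl | ha
      exacts [h, hdom a ha]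
    · push Not at h
      refine ⟨insert x T, Finset.insert_subset_insert _ hTS, fun a ha b hb hab => ?_,
        fun a ha => ?_⟩
      · rcases Finset.mem_insert.1 ha with ha' | ha' <;>
          rcases Finset.mem_insert.1 hb with hb' | hb'
        · exact absurd (ha'.trans hb'.symm) hab
        · exact ha' ▸ h b hb'
        · exact fun hr' => h a ha' (hs _ _ (hb' ▸ hr'))
        · exact hsep a ha' b hb' hab
      · rcases Finset.mem_insert.1 ha with rfl | ha
        · exact ⟨a, Finset.mem_insert_self _ _, hr a⟩
        · obtain ⟨t, ht, hat⟩ := hdom a ha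
          exact ⟨t, Finset.mem_insert_of_mem ht, hat⟩

open Classical in
theorem card_le_card_mul_of_dominating {α β : Type*} (r : α → β → Prop) (S : Finset α)
    (T : Finset β) {m : ℝ} (hdom : ∀ a ∈ S, ∃ t ∈ T, r a t)
    (hm : ∀ t ∈ T, ((S.filter fun a => r a t).card : ℝ) ≤ m) : (S.card : ℝ) ≤ T.card * m := by
  have hsub : S ⊆ T.biUnion fun t => S.filter fun a => r a t := fun a ha => by
    obtain ⟨t, ht, hat⟩ := hdom a ha
    exact Finset.mem_biUnion.2 ⟨t, ht, Finset.mem_filter.2 ⟨ha, hat⟩⟩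
  calc (S.card : ℝ) ≤ ((T.biUnion fun t => S.filter fun a => r a t).card : ℝ) := by
        exact_mod_cast Finset.card_le_card hsub
    _ ≤ ∑ t ∈ T, ((S.filter fun a => r a t).card : ℝ) := by
        exact_mod_cast Finset.card_biUnion_le
    _ ≤ T.card * m := by
        rw [← nsmul_eq_mul]
        exact Finset.sum_le_card_nsmul _ _ _ hm

open Classical in
/-- A separated family in a product, from a set `T₁` of first coordinates with pairwise separated
fibres, each of which is at least half full of good points. -/
theorem exists_separated_of_fibers {A B : Type*} [Fintype B] (g : A × B → Prop)
    (near : A × B → A × B → Prop) (hr : ∀ x, near x x) (hs : ∀ x y, near x y → near y x)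
    (T₁ : Finset A) {m : ℝ}
    (hfib : ∀ a ∈ T₁, (Fintype.card B : ℝ) ≤ 2 * (Finset.univ.filter fun b => g (a, b)).card)
    (hT : ∀ a ∈ T₁, ∀ a' ∈ T₁, a ≠ a' → ∀ b b', ¬ near (a, b) (a', b'))
    (hB : ∀ a b₀ (T : Finset B), (∀ b ∈ T, g (a, b) ∧ near (a, b) (a, b₀)) → (T.card : ℝ) ≤ m) :
    ∃ T : Finset (A × B), (∀ x ∈ T, g x) ∧ (∀ x ∈ T, ∀ y ∈ T, x ≠ y → ¬ near x y) ∧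
      (T₁.card : ℝ) * Fintype.card B ≤ T.card * (2 * m) := by
  let S : Finset (A × B) := (T₁ ×ˢ Finset.univ).filter g
  obtain ⟨T, hTS, hsep, hdom⟩ := exists_separated_dominating near hr hs S
  refine ⟨T, fun x hx => (Finset.mem_filter.1 (hTS hx)).2, hsep, ?_⟩
  have h1 : (S.card : ℝ) ≤ T.card * m := by
    refine card_le_card_mul_of_dominating near S T hdom fun t ht => ?_
    have ht1 : t.1 ∈ T₁ := (Finset.mem_product.1 (Finset.mem_filter.1 (hTS ht)).1).1
    -- Distinct fibres are separated, so a net point dominates only points of its own fibre, and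
    -- there are at most `m` of these.
    have hfst : ∀ x ∈ S.filter fun a => near a t, x.1 = t.1 := fun x hx => by
      obtain ⟨hxS, hxt⟩ := Finset.mem_filter.1 hx
      by_contra hne
      exact hT _ (Finset.mem_product.1 (Finset.mem_filter.1 hxS).1).1 _ ht1 hne _ _ hxt
    rw [← Finset.card_image_of_injOn (f := Prod.snd) fun x hx y hy hxy =>
      Prod.ext ((hfst x hx).trans (hfst y hy).symm) hxy]
    refine hB t.1 t.2 _ fun b hb => ?_
    obtain ⟨x, hx, rfl⟩ := Finset.mem_image.1 hb
    obtain ⟨hxS, hxt⟩ := Finset.mem_filter.1 hx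
    have hx' : (t.1, x.2) = x := Prod.ext (hfst x hx).symm rfl
    rw [hx']
    exact ⟨(Finset.mem_filter.1 hxS).2, hxt⟩
  have h2 : (T₁.card : ℝ) * Fintype.card B ≤ 2 * S.card := by
    have : (S.card : ℝ) = ∑ a ∈ T₁, ((Finset.univ.filter fun b => g (a, b)).card : ℝ) := by
      simp only [S, Finset.card_filter, Finset.sum_product]
      push_cast
      rfl
    rw [this, Finset.mul_sum, ← nsmul_eq_mul]
    exact Finset.card_nsmul_le_sum _ _ _ hfib
  linarith

/-- The indicator of failure of a predicate. -/
def badInd (p : Prop) : ℝ := by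
  classical exact if p then 0 else 1

theorem badInd_nonneg (p : Prop) : 0 ≤ badInd p := by
  unfold badInd; split_ifs <;> norm_num

theorem badInd_of_not {p : Prop} (h : ¬ p) : badInd p = 1 := by simp [badInd, h]

open Classical in
theorem half_le_card_of_badInd {B : Type*} [Fintype B] (g : B → Prop)
    (h : 2 * ∑ b, badInd (g b) ≤ Fintype.card B) :
    (Fintype.card B : ℝ) ≤ 2 * (Finset.univ.filter fun b => g b).card := by
  have h1 : (∑ b, badInd (g b)) + (Finset.univ.filter fun b => g b).card = Fintype.card B := by
    rw [Finset.card_filter, Nat.cast_sum, ← Finset.sum_add_distrib, Fintype.card, Finset.card_eq_sum_ones,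
      Nat.cast_sum]
    refine Finset.sum_congr rfl fun b _ => ?_
    unfold badInd; split_ifs <;> simp
  linarith

open Classical in
-- Averaging over `b` and `c`. The counting argument freezes `c` while `b` varies and conversely, so
-- the base point has to be good and both lines through it at least half good, for many `a` at once.
theorem exists_good_slice {A B C : Type*} [Fintype A] [Fintype B] [Fintype C] [Nonempty B]
    [Nonempty C] (g : A → B → C → Prop)
    (hbad : ∑ a, ∑ b, ∑ c, badInd (g a b c) ≤
      (Fintype.card A * Fintype.card B * Fintype.card C : ℝ) / 10) :
    ∃ (A' : Finset A) (b : B) (c : C), (Fintype.card A : ℝ) ≤ 2 * A'.card ∧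
      ∀ a ∈ A', g a b c ∧
        (Fintype.card B : ℝ) ≤ 2 * (Finset.univ.filter fun b' => g a b' c).card ∧
        (Fintype.card C : ℝ) ≤ 2 * (Finset.univ.filter fun c' => g a b c').card := by
  have hB : (0 : ℝ) < Fintype.card B := by exact_mod_cast Fintype.card_pos
  have hC : (0 : ℝ) < Fintype.card C := by exact_mod_cast Fintype.card_pos
  let f : A → B → C → ℝ := fun a b c => badInd (g a b c)
  -- A score below `1` gives all three properties. The weights `1 + 2 + 2 = 5` turn the bad fraction
  -- `1 / 10` into an average score of at most `1 / 2`, so some `b`, `c` leave at least half of the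
  -- `a` below `1`.
  let score : A → B → C → ℝ := fun a b c => f a b c + 2 / Fintype.card B * ∑ b', f a b' c +
    2 / Fintype.card C * ∑ c', f a b c'
  have htot : ∑ b, ∑ c, ∑ a, score a b c ≤
      ∑ b : B, ∑ c : C, (Fintype.card A : ℝ) / 2 := by
    have e1 : ∑ b, ∑ c, ∑ a, f a b c = ∑ a, ∑ b, ∑ c, f a b c := by
      rw [Finset.sum_comm (s := (Finset.univ : Finset A))]
      exact Finset.sum_congr rfl fun b _ => Finset.sum_comm
    have e2 : ∑ b : B, ∑ c, ∑ a, 2 / (Fintype.card B : ℝ) * ∑ b', f a b' c =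
        2 * ∑ b, ∑ c, ∑ a, f a b c := by
      have : ∑ c, ∑ a, ∑ b', f a b' c = ∑ b, ∑ c, ∑ a, f a b c := by
        rw [Finset.sum_comm (s := (Finset.univ : Finset B)) (t := (Finset.univ : Finset C))]
        refine Finset.sum_congr rfl fun c _ => Finset.sum_comm
      simp_rw [← Finset.mul_sum, this]
      rw [Finset.sum_const, Finset.card_univ, nsmul_eq_mul]
      field_simp
    have e3 : ∑ b, ∑ c : C, ∑ a, 2 / (Fintype.card C : ℝ) * ∑ c', f a b c' =
        2 * ∑ b, ∑ c, ∑ a, f a b c := by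
      have : ∀ b, ∑ a, ∑ c', f a b c' = ∑ c, ∑ a, f a b c := fun b => Finset.sum_comm
      simp_rw [← Finset.mul_sum, this, Finset.sum_const, Finset.card_univ, nsmul_eq_mul]
      rw [Finset.mul_sum, Finset.mul_sum]
      refine Finset.sum_congr rfl fun b _ => ?_
      field_simp
    simp only [score, Finset.sum_add_distrib]
    rw [e2, e3, e1]
    simp only [Finset.sum_const, Finset.card_univ, nsmul_eq_mul]
    have hbad' : ∑ a, ∑ b, ∑ c, f a b c ≤ _ := hbad
    nlinarith
  obtain ⟨b, -, hb⟩ := Finset.exists_le_of_sum_le Finset.univ_nonempty htot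
  obtain ⟨c, -, hc⟩ := Finset.exists_le_of_sum_le Finset.univ_nonempty hb
  have hf0 : ∀ a b c, 0 ≤ f a b c := fun a b c => badInd_nonneg _
  have hs1 : ∀ a c, 0 ≤ 2 / (Fintype.card B : ℝ) * ∑ b' : B, f a b' c := fun a c =>
    mul_nonneg (by positivity) (Finset.sum_nonneg fun _ _ => hf0 _ _ _)
  have hs2 : ∀ a b, 0 ≤ 2 / (Fintype.card C : ℝ) * ∑ c' : C, f a b c' := fun a b =>
    mul_nonneg (by positivity) (Finset.sum_nonneg fun _ _ => hf0 _ _ _)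
  refine ⟨Finset.univ.filter fun a => score a b c < 1, b, c, ?_, fun a ha => ?_⟩
  · refine half_le_card_of_badInd (fun a => score a b c < 1) ?_
    have : ∑ a, badInd (score a b c < 1) ≤ ∑ a, score a b c :=
      Finset.sum_le_sum fun a _ => by
        unfold badInd
        split_ifs with h
        · have := hf0 a b c; have := hs1 a c; have := hs2 a b
          simp only [score]; linarith
        · exact not_lt.1 h
    linarith
  · have ha : score a b c < 1 := (Finset.mem_filter.1 ha).2
    have h0 := hf0 a b c
    have h1 := hs1 a c
    have h2 := hs2 a b
    simp only [score] at ha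
    refine ⟨?_, half_le_card_of_badInd _ ?_, half_le_card_of_badInd _ ?_⟩
    · by_contra hg
      have : f a b c = 1 := badInd_of_not hg
      linarith
    · have : 2 / (Fintype.card B : ℝ) * ∑ b', f a b' c ≤ 1 := by linarith
      rw [div_mul_eq_mul_div, div_le_one hB] at this
      exact this
    · have : 2 / (Fintype.card C : ℝ) * ∑ c', f a b c' ≤ 1 := by linarith
      rw [div_mul_eq_mul_div, div_le_one hC] at this
      exact this

open Classical in
-- The counting form of `2 H(Y) ≥ H(A) + H(B) + H(C)`. Nets `T₁` and `T₂` of the first coordinate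
-- for `p` and `q` satisfy `|A'| ≤ |T₁| |T₂| m`. Over `T₁` the coordinate `b` varies with `c`
-- frozen, giving about `|T₁| |B|` separated points. Over `T₂` the roles of `b` and `c` are
-- exchanged. The product of the two sizes is at least `|A| |B| |C|` up to a power of `m`, and the
-- larger family is kept.
theorem exists_separated_triples {A B C : Type*} [Fintype A] [Fintype B] [Fintype C] [Nonempty B]
    [Nonempty C] (g : A → B → C → Prop)
    (near : A × B × C → A × B × C → Prop) (hr : ∀ x, near x x)
    (hs : ∀ x y, near x y → near y x) (p q : A → A → Prop) (hpr : ∀ a, p a a)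
    (hps : ∀ a b, p a b → p b a) (hqr : ∀ a, q a a) (hqs : ∀ a b, q a b → q b a) {m : ℝ}
    (hm : 0 ≤ m)
    (hbad : ∑ a, ∑ b, ∑ c, badInd (g a b c) ≤
      (Fintype.card A * Fintype.card B * Fintype.card C : ℝ) / 10)
    (hp : ∀ a a' b b' c, near (a, b, c) (a', b', c) → p a a')
    (hq : ∀ a a' b c c', near (a, b, c) (a', b, c') → q a a')
    (hA : ∀ b c t t' (T : Finset A), (∀ a ∈ T, g a b c ∧ p a t ∧ q a t') → (T.card : ℝ) ≤ m)
    (hB : ∀ a c b₀ (T : Finset B), (∀ b ∈ T, g a b c ∧ near (a, b, c) (a, b₀, c)) →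
      (T.card : ℝ) ≤ m)
    (hC : ∀ a b c₀ (T : Finset C), (∀ c ∈ T, g a b c ∧ near (a, b, c) (a, b, c₀)) →
      (T.card : ℝ) ≤ m) :
    ∃ T : Finset (A × B × C), (∀ x ∈ T, g x.1 x.2.1 x.2.2) ∧
      (∀ x ∈ T, ∀ y ∈ T, x ≠ y → ¬ near x y) ∧
      (Fintype.card A * Fintype.card B * Fintype.card C : ℝ) ≤ T.card ^ 2 * (8 * m ^ 3) := by
  obtain ⟨A', b, c, hcard, hA'⟩ := exists_good_slice g hbad
  obtain ⟨T₁, hT₁, hsep₁, hdom₁⟩ := exists_separated_dominating p hpr hps A'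
  obtain ⟨T₂, hT₂, hsep₂, hdom₂⟩ := exists_separated_dominating q hqr hqs A'
  have hprod : (A'.card : ℝ) ≤ T₁.card * T₂.card * m := by
    have := card_le_card_mul_of_dominating (fun a (t : A × A) => p a t.1 ∧ q a t.2) A'
      (T₁ ×ˢ T₂) (m := m) (fun a ha => by
        obtain ⟨t, ht, h1⟩ := hdom₁ a ha
        obtain ⟨t', ht', h2⟩ := hdom₂ a ha
        exact ⟨(t, t'), Finset.mk_mem_product ht ht', h1, h2⟩)
      (fun t _ => by
        refine hA b c t.1 t.2 _ fun a ha => ?_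
        simp only [Finset.mem_filter] at ha
        exact ⟨(hA' a ha.1).1, ha.2⟩)
    rwa [Finset.card_product, Nat.cast_mul] at this
  obtain ⟨S, hSg, hSs, hSc⟩ := exists_separated_of_fibers (fun x : A × B => g x.1 x.2 c)
    (fun x y => near (x.1, x.2, c) (y.1, y.2, c)) (fun _ => hr _) (fun _ _ => hs _ _) T₁
    (fun a ha => (hA' a (hT₁ ha)).2.1)
    (fun a ha a' ha' hne b b' h => hsep₁ a ha a' ha' hne (hp _ _ _ _ _ h))
    (fun a b₀ T hT => hB a c b₀ T hT)
  obtain ⟨S', hSg', hSs', hSc'⟩ := exists_separated_of_fibers (fun x : A × C => g x.1 b x.2)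
    (fun x y => near (x.1, b, x.2) (y.1, b, y.2)) (fun _ => hr _) (fun _ _ => hs _ _) T₂
    (fun a ha => (hA' a (hT₂ ha)).2.2)
    (fun a ha a' ha' hne c c' h => hsep₂ a ha a' ha' hne (hq _ _ _ _ _ h))
    (fun a c₀ T hT => hC a b c₀ T hT)
  have key : (Fintype.card A * Fintype.card B * Fintype.card C : ℝ) ≤
      S.card * S'.card * (8 * m ^ 3) := by
    calc (Fintype.card A * Fintype.card B * Fintype.card C : ℝ)
        ≤ (2 * (T₁.card * T₂.card * m)) * Fintype.card B * Fintype.card C := by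
          gcongr; linarith
      _ = 2 * m * ((T₁.card * Fintype.card B) * (T₂.card * Fintype.card C)) := by ring
      _ ≤ 2 * m * ((S.card * (2 * m)) * (S'.card * (2 * m))) := by gcongr
      _ = _ := by ring
  rcases le_total S.card S'.card with h | h
  · refine ⟨S'.image fun x => (x.1, b, x.2), ?_, ?_, ?_⟩
    · simp only [Finset.mem_image]; rintro _ ⟨x, hx, rfl⟩; exact hSg' x hx
    · simp only [Finset.mem_image]
      rintro _ ⟨x, hx, rfl⟩ _ ⟨y, hy, rfl⟩ hne
      exact hSs' x hx y hy fun h => hne (by rw [h])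
    · rw [Finset.card_image_of_injective _ fun x y h => by
        simp only [Prod.mk.injEq] at h; exact Prod.ext h.1 h.2.2]
      refine key.trans ?_
      rw [sq]; gcongr
  · refine ⟨S.image fun x => (x.1, x.2, c), ?_, ?_, ?_⟩
    · simp only [Finset.mem_image]; rintro _ ⟨x, hx, rfl⟩; exact hSg x hx
    · simp only [Finset.mem_image]
      rintro _ ⟨x, hx, rfl⟩ _ ⟨y, hy, rfl⟩ hne
      exact hSs x hx y hy fun h => hne (by rw [h])
    · rw [Finset.card_image_of_injective _ fun x y h => by
        simp only [Prod.mk.injEq] at h; exact Prod.ext h.1 h.2.1]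
      refine key.trans ?_
      rw [sq]; gcongr

open Classical in
-- By Markov's inequality, at least half of the `v` have a bad fraction of at most `1 / 10`. Each of
-- these carries a separated family of at least `L` triples, and the union over `v` is a family to
-- which `hU` applies.
theorem card_mul_le_of_packing {V A B C : Type*} [Fintype V] [Fintype A] [Fintype B] [Fintype C]
    [Nonempty B] [Nonempty C] (g : V → A → B → C → Prop)
    (near : V → A × B × C → A × B × C → Prop) (hr : ∀ v x, near v x x)
    (hs : ∀ v x y, near v x y → near v y x) (p q : V → A → A → Prop) (hpr : ∀ v a, p v a a)
    (hps : ∀ v a b, p v a b → p v b a) (hqr : ∀ v a, q v a a)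
    (hqs : ∀ v a b, q v a b → q v b a) {m L U : ℝ} (hm : 0 < m) (hL : 0 ≤ L)
    (hbad : ∑ v, ∑ a, ∑ b, ∑ c, badInd (g v a b c) ≤
      Fintype.card V * (Fintype.card A * Fintype.card B * Fintype.card C : ℝ) / 20)
    (hp : ∀ v a a' b b' c, near v (a, b, c) (a', b', c) → p v a a')
    (hq : ∀ v a a' b c c', near v (a, b, c) (a', b, c') → q v a a')
    (hA : ∀ v b c t t' (T : Finset A), (∀ a ∈ T, g v a b c ∧ p v a t ∧ q v a t') →
      (T.card : ℝ) ≤ m)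
    (hB : ∀ v a c b₀ (T : Finset B), (∀ b ∈ T, g v a b c ∧ near v (a, b, c) (a, b₀, c)) →
      (T.card : ℝ) ≤ m)
    (hC : ∀ v a b c₀ (T : Finset C), (∀ c ∈ T, g v a b c ∧ near v (a, b, c) (a, b, c₀)) →
      (T.card : ℝ) ≤ m)
    (hcard : L ^ 2 * (8 * m ^ 3) ≤ Fintype.card A * Fintype.card B * Fintype.card C)
    (hU : ∀ T : Finset (V × A × B × C), (∀ x ∈ T, g x.1 x.2.1 x.2.2.1 x.2.2.2) →
      (∀ x ∈ T, ∀ y ∈ T, x ≠ y → x.1 = y.1 → ¬ near x.1 x.2 y.2) → (T.card : ℝ) ≤ U) :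
    Fintype.card V * L ≤ 2 * U := by
  set D : ℝ := Fintype.card A * Fintype.card B * Fintype.card C with hD
  let F : V → ℝ := fun v => ∑ a, ∑ b, ∑ c, badInd (g v a b c)
  have hF0 : ∀ v, 0 ≤ F v := fun v => Finset.sum_nonneg fun a _ => Finset.sum_nonneg fun b _ =>
    Finset.sum_nonneg fun c _ => badInd_nonneg _
  have hD0 : 0 ≤ D := by positivity
  have hgoodV : (Fintype.card V : ℝ) ≤ 2 * (Finset.univ.filter fun v => F v ≤ D / 10).card := by
    refine half_le_card_of_badInd _ ?_
    -- If there are no triples, Markov's inequality would divide by zero, but then every `F v`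
    -- vanishes.
    rcases hD0.eq_or_lt with h0 | hpos
    · have h1 : ∀ v, F v ≤ D / 10 := fun v => by
        have h2 : ∑ v, F v ≤ 0 := by
          refine hbad.trans ?_
          rw [← h0]; simp
        have h3 := Finset.single_le_sum (fun v _ => hF0 v) (Finset.mem_univ v)
        rw [← h0]; linarith
      simp [badInd, h1]
    · have h1 : ∑ v, badInd (F v ≤ D / 10) ≤ ∑ v, F v * (10 / D) :=
        Finset.sum_le_sum fun v _ => by
          unfold badInd
          split_ifs with h
          · exact mul_nonneg (hF0 v) (by positivity)
          · rw [mul_div_assoc', le_div_iff₀ hpos]; linarith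
      rw [← Finset.sum_mul] at h1
      have h2 : (∑ v, F v) * (10 / D) ≤ Fintype.card V * D / 20 * (10 / D) := by gcongr
      have h3 : Fintype.card V * D / 20 * (10 / D) = (Fintype.card V : ℝ) / 2 := by
        field_simp; ring
      linarith
  have hex : ∀ v, F v ≤ D / 10 → ∃ T : Finset (A × B × C), (∀ x ∈ T, g v x.1 x.2.1 x.2.2) ∧
      (∀ x ∈ T, ∀ y ∈ T, x ≠ y → ¬ near v x y) ∧ L ≤ T.card := fun v hv => by
    obtain ⟨T, h1, h2, h3⟩ := exists_separated_triples (g v) (near v) (hr v) (hs v) (p v) (q v)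
      (hpr v) (hps v) (hqr v) (hqs v) hm.le hv (hp v) (hq v) (hA v) (hB v) (hC v)
    refine ⟨T, h1, h2, ?_⟩
    have h4 : L ^ 2 ≤ (T.card : ℝ) ^ 2 :=
      le_of_mul_le_mul_right (hcard.trans h3) (by positivity)
    exact (sq_le_sq₀ hL (by positivity)).1 h4
  choose! T hTg hTs hTc using hex
  let W : Finset (V × A × B × C) :=
    (Finset.univ.filter fun v => F v ≤ D / 10).biUnion fun v => (T v).image fun x => (v, x)
  have hW : ∀ x ∈ W, F x.1 ≤ D / 10 ∧ x.2 ∈ T x.1 := fun x hx => by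
    obtain ⟨v, hv, hx⟩ := Finset.mem_biUnion.1 hx
    obtain ⟨y, hy, rfl⟩ := Finset.mem_image.1 hx
    exact ⟨(Finset.mem_filter.1 hv).2, hy⟩
  have hWU := hU W (fun x hx => hTg _ (hW x hx).1 _ (hW x hx).2) fun x hx y hy hne h =>
    hTs _ (hW x hx).1 _ (hW x hx).2 _ (h ▸ (hW y hy).2) fun h' => hne (Prod.ext h h')
  have hWc : ((Finset.univ.filter fun v => F v ≤ D / 10).card : ℝ) * L ≤ W.card := by
    rw [Finset.card_biUnion, Nat.cast_sum, ← nsmul_eq_mul]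
    · refine Finset.card_nsmul_le_sum _ _ _ fun v hv => ?_
      rw [Finset.card_image_of_injective _ fun x y h => (Prod.mk.inj h).2]
      exact hTc v (Finset.mem_filter.1 hv).2
    · intro v _ v' _ hne
      refine Finset.disjoint_left.2 ?_
      intro x hx hx'
      obtain ⟨y, -, rfl⟩ := Finset.mem_image.1 hx
      obtain ⟨y', -, h⟩ := Finset.mem_image.1 hx'
      exact hne (congrArg Prod.fst h).symm
  nlinarith

theorem card_le_of_separated_coordinates {X Y Z : Type*} [DecidableEq Y] [DecidableEq Z]
    (T : Finset X) (f : X → Y)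
    (h : X → Z) (hinj : ∀ x y, f x = f y → h x = h y → x = y) :
    T.card ≤ (T.image f).card * (T.image h).card := by
  rw [← Finset.card_product]
  refine Finset.card_le_card_of_injOn (fun x => (f x, h x)) (fun x hx => ?_) fun x _ y _ hxy => ?_
  · exact Finset.mk_mem_product (Finset.mem_image_of_mem _ hx) (Finset.mem_image_of_mem _ hx)
  · exact hinj x y (Prod.mk.inj hxy).1 (Prod.mk.inj hxy).2

end Combinatorics

/-! ### Matrices acting on blocks -/

/-- Multiplication of every entry of a block by the same matrix. -/
def Matrix.mulBlock {n N M : ℕ} (A : Matrix (Fin N) (Fin M) ℂ) (x : Fin n → Fin M → ℂ) :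
    Fin n → Fin N → ℂ := fun t => A.mulVec (x t)

/-- The squared Frobenius norm. -/
def Matrix.frobSq {N M : ℕ} (A : Matrix (Fin N) (Fin M) ℂ) : ℝ := ∑ a, ∑ b, ‖A a b‖ ^ 2

namespace Matrix

variable {n N M L : ℕ}

theorem frobSq_nonneg (A : Matrix (Fin N) (Fin M) ℂ) : 0 ≤ A.frobSq := by
  unfold frobSq; positivity

theorem mulBlock_mulBlock (A : Matrix (Fin L) (Fin N) ℂ) (B : Matrix (Fin N) (Fin M) ℂ)
    (x : Fin n → Fin M → ℂ) : A.mulBlock (B.mulBlock x) = (A * B).mulBlock x :=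
  funext fun _ => Matrix.mulVec_mulVec _ _ _

theorem mulBlock_add (A : Matrix (Fin N) (Fin M) ℂ) (x y : Fin n → Fin M → ℂ) :
    A.mulBlock (x + y) = A.mulBlock x + A.mulBlock y :=
  funext fun _ => Matrix.mulVec_add _ _ _

theorem mulBlock_sub (A : Matrix (Fin N) (Fin M) ℂ) (x y : Fin n → Fin M → ℂ) :
    A.mulBlock (x - y) = A.mulBlock x - A.mulBlock y :=
  funext fun _ => Matrix.mulVec_sub _ _ _

theorem add_mulBlock (A B : Matrix (Fin N) (Fin M) ℂ) (x : Fin n → Fin M → ℂ) :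
    (A + B).mulBlock x = A.mulBlock x + B.mulBlock x :=
  funext fun _ => Matrix.add_mulVec _ _ _

theorem one_mulBlock (x : Fin n → Fin M → ℂ) : (1 : Matrix (Fin M) (Fin M) ℂ).mulBlock x = x :=
  funext fun _ => Matrix.one_mulVec _

theorem zero_mulBlock (x : Fin n → Fin M → ℂ) :
    (0 : Matrix (Fin N) (Fin M) ℂ).mulBlock x = 0 :=
  funext fun _ => Matrix.zero_mulVec _

theorem blockSq_mulBlock_le (A : Matrix (Fin N) (Fin M) ℂ) (x : Fin n → Fin M → ℂ) :
    blockSq (A.mulBlock x) ≤ A.frobSq * blockSq x := by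
  rw [blockSq, blockSq, Finset.mul_sum]
  refine Finset.sum_le_sum fun t _ => ?_
  rw [frobSq, Finset.sum_mul]
  refine Finset.sum_le_sum fun a _ => ?_
  calc ‖A.mulBlock x t a‖ ^ 2 ≤ (∑ b, ‖A a b‖ * ‖x t b‖) ^ 2 := by
        gcongr
        calc ‖A.mulBlock x t a‖ ≤ ∑ b, ‖A a b * x t b‖ :=
              norm_sum_le Finset.univ fun b => A a b * x t b
          _ = _ := by simp
    _ ≤ _ := Finset.sum_mul_sq_le_sq_mul_sq _ _ _

end Matrix

/-! ### Codes: good messages and decoding -/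

namespace XCode

variable {K M N n : ℕ}

/-- The noiseless block at receiver `j`. -/
def signal (c : XCode K M N n) (H : XChannel K M N) (j : Fin K) (w : c.Msg) :
    Fin n → Fin N → ℂ := ∑ i, (H j i).mulBlock (c.enc i (w i))

/-- The probability that receiver `j` errs when the messages are `w`. -/
def errorAt (c : XCode K M N n) (H : XChannel K M N) (j : Fin K) (w : c.Msg) : ℝ :=
  (noiseLaw n N).real {z | c.dec j (c.received H j w z) ≠ fun i => w i j}

/-- The messages `w` are received with small error probability and sent with little power. -/
def Good (c : XCode K M N n) (H : XChannel K M N) (ρ : ℝ) (w : c.Msg) : Prop :=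
  (∀ j, c.errorAt H j w ≤ 1 / 2) ∧ ∀ i, blockSq (c.enc i (w i)) ≤ 120 * n * ρ

theorem received_eq (c : XCode K M N n) (H : XChannel K M N) (j : Fin K) (w : c.Msg)
    (z : Fin n → Fin N → ℂ) : c.received H j w z = c.signal H j w + z := by
  funext t
  simp [received, signal, Matrix.mulBlock]

theorem measurableSet_dec_eq (c : XCode K M N n) (j : Fin K) (m : ∀ i, Fin (c.size i j)) :
    MeasurableSet {y | c.dec j y = m} :=
  c.measurable_dec j (measurableSet_singleton m)

theorem half_le_of_errorAt_le (c : XCode K M N n) {H : XChannel K M N} {j : Fin K} {w : c.Msg}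
    (h : c.errorAt H j w ≤ 1 / 2) :
    1 / 2 ≤ (noiseLaw n N).real {z | c.signal H j w + z ∈ {y | c.dec j y = fun i => w i j}} := by
  have hm : MeasurableSet {z | c.signal H j w + z ∈ {y | c.dec j y = fun i => w i j}} :=
    (measurable_const_add _) (c.measurableSet_dec_eq j _)
  have h1 := probReal_compl_eq_one_sub (μ := noiseLaw n N) hm
  have h2 : {z | c.dec j (c.received H j w z) ≠ fun i => w i j} =
      {z | c.signal H j w + z ∈ {y | c.dec j y = fun i => w i j}}ᶜ := by
    ext z; simp [received_eq]
  rw [errorAt, h2, h1] at h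
  linarith

/-- Few different labels of the messages for receiver `j` fit into a small ball of signals. -/
theorem card_image_le_of_blockSq_le (c : XCode K M N n) (H : XChannel K M N) (j : Fin K)
    {X Y : Type*} [DecidableEq Y] (T : Finset X) (f : X → c.Msg) (h : X → Y)
    (hf : ∀ x y, (fun i => f x i j) = (fun i => f y i j) → h x = h y)
    (herr : ∀ x ∈ T, c.errorAt H j (f x) ≤ 1 / 2) (s : Fin n → Fin N → ℂ) {D : ℝ}
    (hD : ∀ x ∈ T, blockSq (c.signal H j (f x) - s) ≤ D) :
    ((T.image h).card : ℝ) ≤ 2 * (Real.exp D * 2 ^ (n * N)) := by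
  -- One representative per label: different labels mean different messages for receiver `j`, so the
  -- decoding regions are disjoint.
  obtain ⟨S, hST, hsep, hdom⟩ := exists_separated_dominating (fun x y => h x = h y)
    (fun _ => rfl) (fun _ _ h => h.symm) T
  have hinj : Set.InjOn h S := fun x hx y hy hxy => by_contra fun hne => hsep x hx y hy hne hxy
  have hcard : ((T.image h).card : ℝ) ≤ S.card := by
    refine Nat.cast_le.2 ((Finset.card_le_card fun y hy => ?_).trans
      (Finset.card_image_le (s := S) (f := h)))
    obtain ⟨x, hx, rfl⟩ := Finset.mem_image.1 hy
    obtain ⟨t, ht, hxt⟩ := hdom x hx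
    exact Finset.mem_image.2 ⟨t, ht, hxt.symm⟩
  have := card_mul_le_of_disjoint S (fun x => c.signal H j (f x)) s
    (fun x => {y | c.dec j y = fun i => f x i j}) (fun x _ => c.measurableSet_dec_eq j _)
    (fun x hx y hy hne => Set.disjoint_left.2 fun z hz hz' =>
      hne (hinj hx hy (hf _ _ (hz.symm.trans hz'))))
    one_pos (fun x hx => hD x (hST hx)) (fun x hx => c.half_le_of_errorAt_le (herr x (hST hx)))
  norm_num at this
  linarith

theorem signal_sub_eq (c : XCode K M N n) (H : XChannel K M N) (j i : Fin K) {w w' : c.Msg}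
    (h : ∀ k ≠ i, w k = w' k) : c.signal H j w - c.signal H j w' =
      (H j i).mulBlock (c.enc i (w i) - c.enc i (w' i)) := by
  rw [signal, signal, ← Finset.sum_sub_distrib, Finset.sum_eq_single i]
  · rw [Matrix.mulBlock_sub]
  · intro k _ hk; rw [h k hk, sub_self]
  · simp

/-- A union bound with Markov's inequality: the errors contribute `3 · 2 / 240` and the powers `3 /
120`, together `1 / 20`, the fraction that `card_mul_le_of_packing` tolerates. -/
theorem sum_badInd_good_le [NeZero n] (c : XCode 3 M N n) (H : XChannel 3 M N) {ρ : ℝ}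
    (hρ : 0 < ρ) (hpow : ∀ i, c.power i ≤ ρ) (herr : ∀ j, c.errorProb H j ≤ 1 / 240)
    [Nonempty c.Msg] :
    ∑ w, badInd (c.Good H ρ w) ≤ (Fintype.card c.Msg : ℝ) / 20 := by
  have hn : (0 : ℝ) < n := by exact_mod_cast Nat.pos_of_ne_zero (NeZero.ne n)
  have hcard : (0 : ℝ) < Fintype.card c.Msg := by exact_mod_cast Fintype.card_pos
  have h1 : ∀ w, badInd (c.Good H ρ w) ≤
      ∑ j, 2 * c.errorAt H j w + ∑ i, blockSq (c.enc i (w i)) / (120 * n * ρ) := fun w => by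
    have e0 : ∀ j, 0 ≤ 2 * c.errorAt H j w := fun j => mul_nonneg two_pos.le measureReal_nonneg
    have b0 : ∀ i, 0 ≤ blockSq (c.enc i (w i)) / (120 * n * ρ) := fun i =>
      div_nonneg (blockSq_nonneg _) (by positivity)
    have e1 := Finset.sum_nonneg fun j (_ : j ∈ Finset.univ) => e0 j
    have b1 := Finset.sum_nonneg fun j (_ : j ∈ Finset.univ) => b0 j
    unfold badInd
    split_ifs with hg
    · linarith
    · rw [Good, not_and_or] at hg
      push Not at hg
      rcases hg with ⟨j, hj⟩ | ⟨i, hi⟩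
      · have := Finset.single_le_sum (fun j _ => e0 j) (Finset.mem_univ j)
        linarith
      · have := Finset.single_le_sum (fun j _ => b0 j) (Finset.mem_univ i)
        have h2 : 1 ≤ blockSq (c.enc i (w i)) / (120 * n * ρ) := by
          rw [le_div_iff₀ (by positivity)]; linarith
        linarith
  have hE : ∀ j, ∑ w, c.errorAt H j w ≤ Fintype.card c.Msg / 240 := fun j => by
    have := herr j
    rw [errorProb, avg, div_le_iff₀ hcard] at this
    calc _ ≤ _ := this
      _ = _ := by ring
  have hP : ∀ i, ∑ w : c.Msg, blockSq (c.enc i (w i)) ≤ Fintype.card c.Msg * (n * ρ) := fun i => by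
    have := hpow i
    simp only [power, avg] at this
    rw [← Finset.sum_div, one_div, inv_mul_le_iff₀ hn, div_le_iff₀ hcard, Finset.sum_comm] at this
    calc _ ≤ _ := this
      _ = _ := by ring
  refine (Finset.sum_le_sum fun w _ => h1 w).trans ?_
  rw [Finset.sum_add_distrib,
    Finset.sum_comm (f := fun w j => 2 * c.errorAt H j w),
    Finset.sum_comm (f := fun (w : c.Msg) i => blockSq (c.enc i (w i)) / (120 * n * ρ))]
  simp_rw [← Finset.mul_sum, ← Finset.sum_div]
  have h3 : ∑ j, ∑ w, c.errorAt H j w ≤ 3 * (Fintype.card c.Msg / 240 : ℝ) := by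
    refine (Finset.sum_le_sum fun j _ => hE j).trans_eq (by simp)
  have h4 : ∑ i, ∑ w : c.Msg, blockSq (c.enc i (w i)) ≤ 3 * (Fintype.card c.Msg * (n * ρ) : ℝ) := by
    refine (Finset.sum_le_sum fun j _ => hP j).trans_eq (by simp)
  have h5 : (∑ i, ∑ w : c.Msg, blockSq (c.enc i (w i))) / (120 * n * ρ) ≤
      Fintype.card c.Msg / 40 := by
    rw [div_le_iff₀ (by positivity)]
    calc _ ≤ _ := h4
      _ = _ := by ring
  linarith

/-- The messages for receivers `1` and `2` at transmitter `i`. -/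
abbrev Side (c : XCode 3 M N n) (i : Fin 3) : Type := Fin (c.size i 1) × Fin (c.size i 2)

/-- The messages of a three-user code, split into those for receiver `0` and, for each
transmitter, those for the other receivers. -/
def splitMsg (c : XCode 3 M N n) :
    ((∀ i, Fin (c.size i 0)) × c.Side 0 × c.Side 1 × c.Side 2) ≃ c.Msg where
  toFun x i j := match i, j with
    | i, 0 => x.1 i
    | 0, 1 => x.2.1.1
    | 0, 2 => x.2.1.2
    | 1, 1 => x.2.2.1.1
    | 1, 2 => x.2.2.1.2
    | 2, 1 => x.2.2.2.1
    | 2, 2 => x.2.2.2.2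
  invFun w := (fun i => w i 0, (w 0 1, w 0 2), (w 1 1, w 1 2), (w 2 1, w 2 2))
  left_inv x := by
    refine Prod.ext (funext fun i => ?_) rfl
    fin_cases i <;> rfl
  right_inv w := by
    funext i j
    fin_cases i <;> fin_cases j <;> rfl

theorem splitMsg_zero (c : XCode 3 M N n)
    (x : (∀ i, Fin (c.size i 0)) × c.Side 0 × c.Side 1 × c.Side 2) :
    (fun i => c.splitMsg x i 0) = x.1 := by
  funext i
  fin_cases i <;> rfl

end XCode

namespace XCode

variable {M N n : ℕ}

/-- Few good messages of one transmitter for receivers `1` and `2` have codewords in a small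
ball. -/
theorem card_side_le (c : XCode 3 M N n) (H : XChannel 3 M N) {ρ κ D : ℝ} (i : Fin 3)
    (T : Finset (c.Side i)) (f : c.Side i → c.Msg) (hf1 : ∀ x, f x i 1 = x.1)
    (hf2 : ∀ x, f x i 2 = x.2) (hk : ∀ x y, ∀ k ≠ i, f x k = f y k)
    (hg : ∀ x ∈ T, c.Good H ρ (f x)) (hκ : ∀ j, (H j i).frobSq ≤ κ) (x₀ : c.Side i)
    (hD : ∀ x ∈ T, blockSq (c.enc i (f x i) - c.enc i (f x₀ i)) ≤ D) :
    (T.card : ℝ) ≤ (2 * (Real.exp (κ * D) * 2 ^ (n * N))) ^ 2 := by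
  -- Only transmitter `i` varies, so close codewords give close signals at every receiver. Receivers
  -- `1` and `2` nevertheless have to tell the two components apart.
  have hsig : ∀ j, ∀ x ∈ T, blockSq (c.signal H j (f x) - c.signal H j (f x₀)) ≤ κ * D :=
    fun j x hx => by
      rw [c.signal_sub_eq H j i (hk x x₀)]
      refine (Matrix.blockSq_mulBlock_le _ _).trans ?_
      exact mul_le_mul (hκ j) (hD x hx) (blockSq_nonneg _) ((Matrix.frobSq_nonneg _).trans (hκ j))
  have h1 := c.card_image_le_of_blockSq_le H 1 T f Prod.fst
    (fun x y h => by rw [← hf1 x, ← hf1 y]; exact congrFun h i) (fun x hx => (hg x hx).1 1) _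
    (hsig 1)
  have h2 := c.card_image_le_of_blockSq_le H 2 T f Prod.snd
    (fun x y h => by rw [← hf2 x, ← hf2 y]; exact congrFun h i) (fun x hx => (hg x hx).1 2) _
    (hsig 2)
  have h3 := card_le_of_separated_coordinates T Prod.fst Prod.snd fun x y => Prod.ext
  rw [sq]
  calc (T.card : ℝ) ≤ (T.image Prod.fst).card * (T.image Prod.snd).card := by exact_mod_cast h3
    _ ≤ _ := by gcongr

theorem blockSq_signal_le (c : XCode 3 M N n) (H : XChannel 3 M N) (j : Fin 3) (w : c.Msg) {B : ℝ}
    (hB : ∀ i, blockSq (c.enc i (w i)) ≤ B) :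
    blockSq (c.signal H j w) ≤ 4 * (∑ i, (H j i).frobSq) * B := by
  have h : ∀ i, blockSq ((H j i).mulBlock (c.enc i (w i))) ≤ (H j i).frobSq * B := fun i =>
    (Matrix.blockSq_mulBlock_le _ _).trans
      (mul_le_mul_of_nonneg_left (hB i) (Matrix.frobSq_nonneg _))
  have e1 := blockSq_add_le one_pos
    ((H j 0).mulBlock (c.enc 0 (w 0)) + (H j 1).mulBlock (c.enc 1 (w 1)))
    ((H j 2).mulBlock (c.enc 2 (w 2)))
  have e2 := blockSq_add_le one_pos
    ((H j 0).mulBlock (c.enc 0 (w 0))) ((H j 1).mulBlock (c.enc 1 (w 1)))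
  rw [signal, Fin.sum_univ_three, Fin.sum_univ_three]
  norm_num at e1 e2
  have h0 := h 0
  have h1 := h 1
  have h2 := h 2
  have := (blockSq_nonneg _).trans h2
  linarith

/-- Good messages whose signals at receiver `0` are separated, unless the receiver distinguishes
them, are limited in number by the transmit power. -/
theorem card_le_of_signals_separated [NeZero n] (c : XCode 3 M 3 n) (H : XChannel 3 M 3) {ρ : ℝ}
    (hρ : 0 < ρ) {X : Type*} (T : Finset X) (f : X → c.Msg) (hg : ∀ x ∈ T, c.Good H ρ (f x))
    (hsep : ∀ x ∈ T, ∀ y ∈ T, x ≠ y → (fun i => f x i 0) = (fun i => f y i 0) →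
      ¬ blockSq (c.signal H 0 (f x) - c.signal H 0 (f y)) ≤ 48 * n) :
    (T.card : ℝ) ≤ 4 * (Real.exp (480 * (∑ i, (H 0 i).frobSq) * n) * (1 + ρ) ^ (n * 3)) := by
  have hball : ∀ s : Fin n → Fin 3 → ℂ, MeasurableSet {y | blockSq (y - s) ≤ 12 * n} := fun s =>
    measurableSet_le (measurable_blockSq.comp (measurable_sub_const s)) measurable_const
  -- Decoding regions separate different messages for receiver `0`. Intersecting with noise balls
  -- also separates signals with equal messages, at the cost of lowering the mass from `1 / 2` to `1
  -- / 4`. With `τ = ρ` the power cancels in the exponent.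
  have key := card_mul_le_of_disjoint T (fun x => c.signal H 0 (f x)) 0
    (fun x => {y | c.dec 0 y = fun i => f x i 0} ∩
      {y | blockSq (y - c.signal H 0 (f x)) ≤ 12 * n}) (p := 1 / 4)
    (B := 4 * (∑ i, (H 0 i).frobSq) * (120 * n * ρ))
    (fun x _ => (c.measurableSet_dec_eq 0 _).inter (hball _)) ?_ hρ
    (fun x hx => by
      rw [sub_zero]
      exact c.blockSq_signal_le H 0 (f x) (hg x hx).2) ?_
  · rw [show 4 * (∑ i, (H 0 i).frobSq) * (120 * n * ρ) / ρ = 480 * (∑ i, (H 0 i).frobSq) * n by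
      field_simp; ring] at key
    linarith
  · intro x hx y hy hne
    refine Set.disjoint_left.2 fun z hz hz' => hsep x hx y hy hne (hz.1.symm.trans hz'.1) ?_
    -- The threshold `48 n` is `2 · 12 n + 2 · 12 n`: a common point of two balls would make the
    -- signals near.
    have h1 := blockSq_sub_le (c.signal H 0 (f x)) z (c.signal H 0 (f y))
    rw [blockSq_sub_comm _ z] at h1
    have h2 : blockSq (z - c.signal H 0 (f x)) ≤ 12 * n := hz.2
    have h3 : blockSq (z - c.signal H 0 (f y)) ≤ 12 * n := hz'.2
    linarith
  · intro x hx
    have h1 := c.half_le_of_errorAt_le ((hg x hx).1 0)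
    have h2 := noiseLaw_blockSq_gt_le (NeZero.ne n)
    have h3 : {z | c.signal H 0 (f x) + z ∈ {y | c.dec 0 y = fun i => f x i 0}} ⊆
        {z | c.signal H 0 (f x) + z ∈ {y | c.dec 0 y = fun i => f x i 0} ∩
          {y | blockSq (y - c.signal H 0 (f x)) ≤ 12 * n}} ∪
        {z | 12 * (n : ℝ) < blockSq z} := fun z hz => by
      by_cases h : 12 * (n : ℝ) < blockSq z
      · exact Or.inr h
      · refine Or.inl ⟨hz, ?_⟩
        simpa using h
    have h4 := (measureReal_mono (μ := noiseLaw n 3) h3).trans (measureReal_union_le _ _)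
    linarith

end XCode

/-! ### Zero forcing and the rate bound -/

/-- Receiver `0` can null transmitter `1` with `U` and transmitter `2` with `W`, and the two
combinations of its antennas then determine the input of transmitter `0`; without the other
transmitters it can invert the channels from transmitters `1` and `2`. -/
structure ZeroForcing {M : ℕ} (H : XChannel 3 M 3) where
  U : Matrix (Fin 1) (Fin 3) ℂ
  W : Matrix (Fin 1) (Fin 3) ℂ
  P : Matrix (Fin M) (Fin 1) ℂ
  Q : Matrix (Fin M) (Fin 1) ℂ
  L₁ : Matrix (Fin M) (Fin 3) ℂ
  L₂ : Matrix (Fin M) (Fin 3) ℂ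
  U_mul : U * H 0 1 = 0
  W_mul : W * H 0 2 = 0
  recover : P * (U * H 0 0) + Q * (W * H 0 0) = 1
  L₁_mul : L₁ * H 0 1 = 1
  L₂_mul : L₂ * H 0 2 = 1

namespace ZeroForcing

variable {M n : ℕ} {H : XChannel 3 M 3}

/-- The squared radius, per channel use, within which codewords cannot be told apart. -/
def radius (Z : ZeroForcing H) : ℝ :=
  384 * (Z.P.frobSq * Z.U.frobSq + Z.Q.frobSq * Z.W.frobSq) +
    48 * (Z.L₁.frobSq + Z.L₂.frobSq)

theorem blockSq_le_of_leftInverse {N : ℕ} {A : Matrix (Fin N) (Fin M) ℂ}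
    {B : Matrix (Fin M) (Fin N) ℂ} (h : B * A = 1) (x : Fin n → Fin M → ℂ) :
    blockSq x ≤ B.frobSq * blockSq (A.mulBlock x) := by
  conv_lhs => rw [← Matrix.one_mulBlock x, ← h, ← Matrix.mulBlock_mulBlock]
  exact Matrix.blockSq_mulBlock_le _ _

theorem blockSq_le_of_recover (Z : ZeroForcing H) (x : Fin n → Fin M → ℂ) :
    blockSq x ≤ 2 * (Z.P.frobSq * blockSq ((Z.U * H 0 0).mulBlock x)) +
      2 * (Z.Q.frobSq * blockSq ((Z.W * H 0 0).mulBlock x)) := by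
  have h : x = Z.P.mulBlock ((Z.U * H 0 0).mulBlock x) +
      Z.Q.mulBlock ((Z.W * H 0 0).mulBlock x) := by
    rw [Matrix.mulBlock_mulBlock, Matrix.mulBlock_mulBlock, ← Matrix.add_mulBlock, Z.recover,
      Matrix.one_mulBlock]
  have h1 := blockSq_add_le one_pos (Z.P.mulBlock ((Z.U * H 0 0).mulBlock x))
    (Z.Q.mulBlock ((Z.W * H 0 0).mulBlock x))
  rw [← h] at h1
  have h2 := Matrix.blockSq_mulBlock_le Z.P ((Z.U * H 0 0).mulBlock x)
  have h3 := Matrix.blockSq_mulBlock_le Z.Q ((Z.W * H 0 0).mulBlock x)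
  norm_num at h1
  linarith

set_option maxHeartbeats 400000 in
/-- The rate bound for a single code. -/
theorem rate_le_of_code [NeZero n] (Z : ZeroForcing H) (c : XCode 3 M 3 n) {ρ R : ℝ} (hρ : 0 < ρ)
    (hpow : ∀ i, c.power i ≤ ρ) (hsize : ∀ i j, Real.exp (n * R) ≤ c.size i j)
    (herr : ∀ j, c.errorProb H j ≤ 1 / 240) :
    Real.exp (3 * (n * R)) * Real.exp (3 * (n * R)) ≤
      3 * (2 * (Real.exp ((∑ j, ∑ i, (H j i).frobSq) * (Z.radius * n)) * 2 ^ (n * 3))) ^ 3 *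
        (2 * (4 * (Real.exp (480 * (∑ i, (H 0 i).frobSq) * n) * (1 + ρ) ^ (n * 3)))) := by
  have hpos : ∀ i j, 0 < c.size i j := fun i j => by
    exact_mod_cast (Real.exp_pos _).trans_le (hsize i j)
  have hne : ∀ i j, Nonempty (Fin (c.size i j)) := fun i j => ⟨⟨0, hpos i j⟩⟩
  have : Nonempty c.Msg := ⟨fun i j => ⟨0, hpos i j⟩⟩
  set κ : ℝ := ∑ j, ∑ i, (H j i).frobSq with hκ
  have hκle : ∀ i j, (H j i).frobSq ≤ κ := fun i j => by
    have h1 := Finset.single_le_sum (f := fun i => (H j i).frobSq)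
      (fun i _ => Matrix.frobSq_nonneg _) (Finset.mem_univ i)
    have h2 := Finset.single_le_sum (f := fun j => ∑ i, (H j i).frobSq)
      (fun j _ => Finset.sum_nonneg fun i _ => Matrix.frobSq_nonneg _) (Finset.mem_univ j)
    exact h1.trans h2
  set μ : ℝ := 2 * (Real.exp (κ * (Z.radius * n)) * 2 ^ (n * 3)) with hμ
  have hμ0 : 0 < μ := by positivity
  have fP := Z.P.frobSq_nonneg
  have fQ := Z.Q.frobSq_nonneg
  have fU := Z.U.frobSq_nonneg
  have fW := Z.W.frobSq_nonneg
  have f1 := Z.L₁.frobSq_nonneg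
  have f2 := Z.L₂.frobSq_nonneg
  have hPU : 0 ≤ Z.P.frobSq * Z.U.frobSq := mul_nonneg fP fU
  have hQW : 0 ≤ Z.Q.frobSq * Z.W.frobSq := mul_nonneg fQ fW
  have hn0 : (0 : ℝ) ≤ n := Nat.cast_nonneg n
  let sig := fun x => c.signal H 0 (c.splitMsg x)
  -- The codeword of transmitter `0` depends on `v` and `a` alone, so `p` and `q` can be stated
  -- without `b` and `d`.
  let X₀ : (∀ i, Fin (c.size i 0)) → c.Side 0 → Fin n → Fin M → ℂ := fun v a =>
    c.enc 0 fun j => match j with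
      | 0 => v 0
      | 1 => a.1
      | 2 => a.2
  have hX₀ : ∀ v a b d, c.enc 0 (c.splitMsg (v, a, b, d) 0) = X₀ v a := fun v a b d => by
    refine congrArg _ (funext fun j => ?_)
    fin_cases j <;> rfl
  have agree0 : ∀ v a a' b d, ∀ k ≠ 0,
      c.splitMsg (v, a, b, d) k = c.splitMsg (v, a', b, d) k := fun v a a' b d k hk => by
    funext j
    fin_cases k
    · exact absurd rfl hk
    all_goals fin_cases j <;> rfl
  have agree1 : ∀ v a b b' d, ∀ k ≠ 1,
      c.splitMsg (v, a, b, d) k = c.splitMsg (v, a, b', d) k := fun v a b b' d k hk => by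
    funext j
    fin_cases k
    · fin_cases j <;> rfl
    · exact absurd rfl hk
    · fin_cases j <;> rfl
  have agree2 : ∀ v a b d d', ∀ k ≠ 2,
      c.splitMsg (v, a, b, d) k = c.splitMsg (v, a, b, d') k := fun v a b d d' k hk => by
    funext j
    fin_cases k
    · fin_cases j <;> rfl
    · fin_cases j <;> rfl
    · exact absurd rfl hk
  have hcardV : Real.exp (3 * (n * R)) ≤ Fintype.card (∀ i, Fin (c.size i 0)) := by
    rw [show (3 : ℝ) * (n * R) = n * R + n * R + n * R by ring, Real.exp_add, Real.exp_add,
      Fintype.card_pi, Fin.prod_univ_three]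
    simp only [Fintype.card_fin]
    push_cast
    gcongr <;> exact hsize _ _
  have hcardI : ∀ i, Real.exp (2 * (n * R)) ≤ Fintype.card (c.Side i) := fun i => by
    rw [show (2 : ℝ) * (n * R) = n * R + n * R by ring, Real.exp_add, Fintype.card_prod]
    simp only [Fintype.card_fin]
    push_cast
    gcongr <;> exact hsize _ _
  -- Near triples that share `d` differ in `X₀` and transmitter `1`, which `U` nulls; this gives
  -- `p`. Likewise `W` gives `q` when `b` is shared. The `3` in `L` makes its square cancel `8 m ^ 3
  -- = 8 μ ^ 6`, as `8 ≤ 3 ^ 2`.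
  have main := card_mul_le_of_packing
    (fun v a b d => c.Good H ρ (c.splitMsg (v, a, b, d)))
    (fun v x y => blockSq (sig (v, x) - sig (v, y)) ≤ 48 * n)
    (fun v x => by simp [blockSq]) (fun v x y h => by rwa [blockSq_sub_comm])
    (fun v a a' => blockSq ((Z.U * H 0 0).mulBlock (X₀ v a - X₀ v a')) ≤ Z.U.frobSq * (48 * n))
    (fun v a a' => blockSq ((Z.W * H 0 0).mulBlock (X₀ v a - X₀ v a')) ≤ Z.W.frobSq * (48 * n))
    (fun v a => by
      rw [Matrix.mulBlock_sub, sub_self]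
      exact (by simp [blockSq] : blockSq (0 : Fin n → Fin 1 → ℂ) = 0).trans_le (by positivity))
    (fun v a a' h => by rwa [Matrix.mulBlock_sub, blockSq_sub_comm, ← Matrix.mulBlock_sub])
    (fun v a => by
      rw [Matrix.mulBlock_sub, sub_self]
      exact (by simp [blockSq] : blockSq (0 : Fin n → Fin 1 → ℂ) = 0).trans_le (by positivity))
    (fun v a a' h => by rwa [Matrix.mulBlock_sub, blockSq_sub_comm, ← Matrix.mulBlock_sub])
    (m := μ ^ 2) (L := Real.exp (3 * (n * R)) / (3 * μ ^ 3))
    (U := 4 * (Real.exp (480 * (∑ i, (H 0 i).frobSq) * n) * (1 + ρ) ^ (n * 3)))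
    (by positivity) (by positivity) ?_ ?_ ?_ ?_ ?_ ?_ ?_ ?_
  · rw [mul_div_assoc', div_le_iff₀ (by positivity)] at main
    calc _ ≤ Fintype.card (∀ i, Fin (c.size i 0)) * Real.exp (3 * (n * R)) := by gcongr
      _ ≤ _ := main
      _ = _ := by ring
  · have h := c.sum_badInd_good_le H hρ hpow herr
    rw [← Equiv.sum_comp c.splitMsg, ← Fintype.card_congr c.splitMsg] at h
    rw [Fintype.sum_prod_type] at h
    calc _ = ∑ v, ∑ x : c.Side 0 × c.Side 1 × c.Side 2,
          badInd (c.Good H ρ (c.splitMsg (v, x))) := by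
          refine Finset.sum_congr rfl fun v _ => ?_
          rw [Fintype.sum_prod_type fun x : c.Side 0 × c.Side 1 × c.Side 2 =>
            badInd (c.Good H ρ (c.splitMsg (v, x)))]
          exact Finset.sum_congr rfl fun a _ => (Fintype.sum_prod_type fun x =>
            badInd (c.Good H ρ (c.splitMsg (v, a, x)))).symm
      _ ≤ _ := h
      _ = _ := by
          rw [Fintype.card_prod, Fintype.card_prod (c.Side 0), Fintype.card_prod (c.Side 1)]
          push_cast
          ring
  · intro v a a' b b' d h
    have e : sig (v, a, b, d) - sig (v, a', b', d) =
        (H 0 0).mulBlock (X₀ v a - X₀ v a') + (H 0 1).mulBlock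
          (c.enc 1 (c.splitMsg (v, a', b, d) 1) - c.enc 1 (c.splitMsg (v, a', b', d) 1)) := by
      rw [← hX₀ v a b d, ← hX₀ v a' b d, ← c.signal_sub_eq H 0 0 (agree0 v a a' b d),
        ← c.signal_sub_eq H 0 1 (agree1 v a' b b' d), sub_add_sub_cancel]
    have e1 := Matrix.blockSq_mulBlock_le Z.U (sig (v, a, b, d) - sig (v, a', b', d))
    rw [e, Matrix.mulBlock_add, Matrix.mulBlock_mulBlock, Matrix.mulBlock_mulBlock, Z.U_mul,
      Matrix.zero_mulBlock, add_zero, ← e] at e1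
    exact e1.trans (mul_le_mul_of_nonneg_left h fU)
  · intro v a a' b d d' h
    have e : sig (v, a, b, d) - sig (v, a', b, d') =
        (H 0 0).mulBlock (X₀ v a - X₀ v a') + (H 0 2).mulBlock
          (c.enc 2 (c.splitMsg (v, a', b, d) 2) - c.enc 2 (c.splitMsg (v, a', b, d') 2)) := by
      rw [← hX₀ v a b d, ← hX₀ v a' b d, ← c.signal_sub_eq H 0 0 (agree0 v a a' b d),
        ← c.signal_sub_eq H 0 2 (agree2 v a' b d d'), sub_add_sub_cancel]
    have e1 := Matrix.blockSq_mulBlock_le Z.W (sig (v, a, b, d) - sig (v, a', b, d'))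
    rw [e, Matrix.mulBlock_add, Matrix.mulBlock_mulBlock, Matrix.mulBlock_mulBlock, Z.W_mul,
      Matrix.zero_mulBlock, add_zero, ← e] at e1
    exact e1.trans (mul_le_mul_of_nonneg_left h fW)
  · intro v b d t t' T hT
    rcases T.eq_empty_or_nonempty with rfl | ⟨a₀, ha₀⟩
    · simp only [Finset.card_empty, Nat.cast_zero]; positivity
    refine c.card_side_le H 0 T (fun a => c.splitMsg (v, a, b, d)) (fun _ => rfl) (fun _ => rfl)
      (fun x y => agree0 v x y b d) (fun x hx => (hT x hx).1) (hκle 0) a₀ fun a ha => ?_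
    rw [hX₀, hX₀]
    obtain ⟨-, hp, hq⟩ := hT a ha
    obtain ⟨-, hp₀, hq₀⟩ := hT a₀ ha₀
    -- The centres `t` and `t'` need not agree, so both projections are compared with those of one
    -- member `a₀`. Recovering the codeword doubles once more: `384 = 2 · (2 · 48 + 2 · 48)`.
    have e1 := blockSq_sub_le ((Z.U * H 0 0).mulBlock (X₀ v a)) ((Z.U * H 0 0).mulBlock (X₀ v t))
      ((Z.U * H 0 0).mulBlock (X₀ v a₀))
    have e2 := blockSq_sub_le ((Z.W * H 0 0).mulBlock (X₀ v a)) ((Z.W * H 0 0).mulBlock (X₀ v t'))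
      ((Z.W * H 0 0).mulBlock (X₀ v a₀))
    rw [blockSq_sub_comm ((Z.U * H 0 0).mulBlock (X₀ v t))] at e1
    rw [blockSq_sub_comm ((Z.W * H 0 0).mulBlock (X₀ v t'))] at e2
    rw [Matrix.mulBlock_sub] at hp hq hp₀ hq₀
    have e3 := Z.blockSq_le_of_recover (X₀ v a - X₀ v a₀)
    rw [Matrix.mulBlock_sub, Matrix.mulBlock_sub] at e3
    have e4 := mul_le_mul_of_nonneg_left (e1.trans (add_le_add
      (mul_le_mul_of_nonneg_left hp two_pos.le) (mul_le_mul_of_nonneg_left hp₀ two_pos.le))) fP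
    have e5 := mul_le_mul_of_nonneg_left (e2.trans (add_le_add
      (mul_le_mul_of_nonneg_left hq two_pos.le) (mul_le_mul_of_nonneg_left hq₀ two_pos.le))) fQ
    have e6 : 0 ≤ 48 * (Z.L₁.frobSq + Z.L₂.frobSq) * n := by positivity
    rw [radius]
    linarith
  · intro v a d b₀ T hT
    refine c.card_side_le H 1 T (fun b => c.splitMsg (v, a, b, d)) (fun _ => rfl) (fun _ => rfl)
      (fun x y => agree1 v a x y d) (fun x hx => (hT x hx).1) (hκle 1) b₀ fun b hb => ?_
    refine (blockSq_le_of_leftInverse Z.L₁_mul _).trans ?_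
    rw [← c.signal_sub_eq H 0 1 (agree1 v a b b₀ d)]
    have e1 := mul_le_mul_of_nonneg_left (hT b hb).2 f1
    have e2 : 0 ≤ (384 * (Z.P.frobSq * Z.U.frobSq + Z.Q.frobSq * Z.W.frobSq) +
      48 * Z.L₂.frobSq) * n := by positivity
    refine e1.trans ?_
    rw [radius]
    linarith
  · intro v a b d₀ T hT
    refine c.card_side_le H 2 T (fun d => c.splitMsg (v, a, b, d)) (fun _ => rfl) (fun _ => rfl)
      (fun x y => agree2 v a b x y) (fun x hx => (hT x hx).1) (hκle 2) d₀ fun d hd => ?_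
    refine (blockSq_le_of_leftInverse Z.L₂_mul _).trans ?_
    rw [← c.signal_sub_eq H 0 2 (agree2 v a b d d₀)]
    have e1 := mul_le_mul_of_nonneg_left (hT d hd).2 f2
    have e2 : 0 ≤ (384 * (Z.P.frobSq * Z.U.frobSq + Z.Q.frobSq * Z.W.frobSq) +
      48 * Z.L₁.frobSq) * n := by positivity
    refine e1.trans ?_
    rw [radius]
    linarith
  · rw [div_pow, div_mul_eq_mul_div, div_le_iff₀ (by positivity)]
    have h : Real.exp (3 * (n * R)) ^ 2 = Real.exp (2 * (n * R)) * Real.exp (2 * (n * R)) *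
        Real.exp (2 * (n * R)) := by
      rw [← Real.exp_add, ← Real.exp_add, ← Real.exp_nat_mul]
      congr 1; push_cast; ring
    have h1 : Real.exp (3 * (n * R)) ^ 2 ≤ Fintype.card (c.Side 0) * Fintype.card (c.Side 1) *
        Fintype.card (c.Side 2) := by
      rw [h]; gcongr <;> exact hcardI _
    calc Real.exp (3 * (n * R)) ^ 2 * (8 * (μ ^ 2) ^ 3)
        ≤ Real.exp (3 * (n * R)) ^ 2 * (9 * (μ ^ 2) ^ 3) := by gcongr; norm_num
      _ = Real.exp (3 * (n * R)) ^ 2 * (3 * μ ^ 3) ^ 2 := by ring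
      _ ≤ _ := by gcongr
  · intro T hg hsep
    refine c.card_le_of_signals_separated H hρ T (fun x => c.splitMsg x) (fun x hx => hg x hx)
      fun x hx y hy hne h => ?_
    rw [c.splitMsg_zero, c.splitMsg_zero] at h
    obtain ⟨v, x⟩ := x
    obtain ⟨v', y⟩ := y
    obtain rfl : v = v' := h
    exact hsep (v, x) hx (v, y) hy hne rfl

/-- The offset in the rate bound, independent of the power. -/
def offset (Z : ZeroForcing H) : ℝ :=
  Real.log 192 + 3 * ((∑ j, ∑ i, (H j i).frobSq) * Z.radius + 3 * Real.log 2) +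
    480 * ∑ i, (H 0 i).frobSq

/-- A single code of error at most `1 / 240` suffices, as the bound for one code is exponential in
`n` up to the factor `192 = 3 · 2 ^ 3 · 2 · 4`. -/
theorem rate_le (Z : ZeroForcing H) {ρ R : ℝ} (hρ : 0 < ρ) (h : SymAchievable H ρ R) :
    6 * R ≤ Z.offset + 3 * Real.log (1 + ρ) := by
  obtain ⟨n, ⟨c, hpow, hsize, herr⟩, hn⟩ :=
    ((h (1 / 240) (by norm_num)).and (eventually_ge_atTop 1)).exists
  have : NeZero n := ⟨by omega⟩
  have hn1 : (1 : ℝ) ≤ n := by exact_mod_cast hn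
  have key := Z.rate_le_of_code c hρ hpow hsize herr
  set κ : ℝ := ∑ j, ∑ i, (H j i).frobSq
  set σ : ℝ := ∑ i, (H 0 i).frobSq
  have e : ∀ x : ℝ, 0 < x → ∀ k : ℕ, x ^ k = Real.exp (k * Real.log x) := fun x hx k => by
    rw [Real.exp_nat_mul, Real.exp_log hx]
  have h1 : 3 * (2 * (Real.exp (κ * (Z.radius * n)) * 2 ^ (n * 3))) ^ 3 *
      (2 * (4 * (Real.exp (480 * σ * n) * (1 + ρ) ^ (n * 3)))) =
      Real.exp (Real.log 192 + n * (3 * (κ * Z.radius + 3 * Real.log 2) + 480 * σ +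
        3 * Real.log (1 + ρ))) := by
    rw [e 2 two_pos, e (1 + ρ) (by positivity), ← Real.exp_add, mul_pow, ← Real.exp_nat_mul,
      show Real.log 192 + n * (3 * (κ * Z.radius + 3 * Real.log 2) + 480 * σ +
        3 * Real.log (1 + ρ)) = Real.log 192 + (((3 : ℕ) * (κ * (Z.radius * n) +
          (n * 3 : ℕ) * Real.log 2)) + (480 * σ * n + (n * 3 : ℕ) * Real.log (1 + ρ))) by
        push_cast; ring, Real.exp_add, Real.exp_add, Real.exp_add (480 * σ * n),
      Real.exp_log (by norm_num)]
    ring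
  rw [h1, ← Real.exp_add, Real.exp_le_exp] at key
  have h2 : Real.log 192 ≤ n * Real.log 192 :=
    le_mul_of_one_le_left (Real.log_nonneg (by norm_num)) hn1
  refine le_of_mul_le_mul_left ?_ (by linarith : (0 : ℝ) < n)
  rw [offset]
  linarith

theorem symDoF_le (Z : ZeroForcing H) : symDoF H ≤ ENNReal.ofReal (1 / 2) := by
  have hcap : ∀ ρ : ℝ, 0 < ρ → symCapacity H ρ ≤
      ENNReal.ofReal ((Z.offset + 3 * Real.log (1 + ρ)) / 6) := fun ρ hρ => by
    refine iSup₂_le fun R hR => ?_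
    rw [← ENNReal.ofReal_coe_nnreal]
    have := Z.rate_le hρ hR
    exact ENNReal.ofReal_le_ofReal (by linarith)
  have hlim : Tendsto (fun ρ : ℝ => (Z.offset + 3 * (Real.log 2 + Real.log ρ)) / 6 / Real.log ρ)
      atTop (𝓝 (1 / 2)) := by
    have h1 : Tendsto (fun ρ : ℝ => (Z.offset + 3 * Real.log 2) / 6 * (Real.log ρ)⁻¹ + 1 / 2)
        atTop (𝓝 ((Z.offset + 3 * Real.log 2) / 6 * 0 + 1 / 2)) :=
      ((tendsto_inv_atTop_zero.comp Real.tendsto_log_atTop).const_mul _).add_const _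
    rw [mul_zero, zero_add] at h1
    refine h1.congr' ?_
    filter_upwards [eventually_gt_atTop 1] with ρ hρ
    have := Real.log_pos hρ
    field_simp
    ring
  have hlim' := ENNReal.tendsto_ofReal hlim
  rw [← hlim'.limsup_eq]
  refine limsup_le_limsup ?_
  filter_upwards [eventually_gt_atTop 1] with ρ hρ
  have hlog := Real.log_pos hρ
  rw [ENNReal.ofReal_div_of_pos hlog]
  gcongr
  refine (hcap ρ (by linarith)).trans (ENNReal.ofReal_le_ofReal ?_)
  have : Real.log (1 + ρ) ≤ Real.log 2 + Real.log ρ := by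
    rw [← Real.log_mul two_ne_zero (by linarith)]
    exact Real.log_le_log (by linarith) (by linarith)
  linarith

end ZeroForcing

/-! ### Zero forcing for generic channels -/

section ZeroForcingDet

variable {R : Type*} [CommRing R]

/-- The row of `2 × 2` minors of a `3 × 2` matrix, the cross product of its columns. -/
def minorRow (b : Matrix (Fin 3) (Fin 2) R) : Matrix (Fin 1) (Fin 3) R :=
  !![b 1 0 * b 2 1 - b 2 0 * b 1 1, b 2 0 * b 0 1 - b 0 0 * b 2 1, b 0 0 * b 1 1 - b 1 0 * b 0 1]

/-- The determinant of the channel from transmitter `0` to receiver `0`, seen through the rows that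
null transmitters `1` and `2`. -/
def zeroForcingDet (h b c : Matrix (Fin 3) (Fin 2) R) : R :=
  (minorRow b * h) 0 0 * (minorRow c * h) 0 1 - (minorRow b * h) 0 1 * (minorRow c * h) 0 0

theorem minorRow_mul_self (b : Matrix (Fin 3) (Fin 2) R) : minorRow b * b = 0 := by
  ext i j
  fin_cases i; fin_cases j <;> simp [minorRow, Matrix.mul_apply, Fin.sum_univ_three] <;> ring

/-- The hypothesis says that `b` with the extra column `w` has determinant `1`. The witness is the
first two rows of the adjugate. -/
theorem exists_leftInverse_of_minorRow (b : Matrix (Fin 3) (Fin 2) R) (w : Fin 3 → R)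
    (h : minorRow b 0 0 * w 0 + minorRow b 0 1 * w 1 + minorRow b 0 2 * w 2 = 1) :
    ∃ L : Matrix (Fin 2) (Fin 3) R, L * b = 1 := by
  refine ⟨!![b 1 1 * w 2 - b 2 1 * w 1, b 2 1 * w 0 - b 0 1 * w 2, b 0 1 * w 1 - b 1 1 * w 0;
    w 1 * b 2 0 - w 2 * b 1 0, w 2 * b 0 0 - w 0 * b 2 0, w 0 * b 1 0 - w 1 * b 0 0], ?_⟩
  simp only [minorRow, Matrix.of_apply, Matrix.cons_val] at h
  ext i j
  fin_cases i <;> fin_cases j <;>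
    simp [Matrix.mul_apply, Fin.sum_univ_three, Matrix.of_apply, Matrix.cons_val] <;>
    first | ring1 | linear_combination h

end ZeroForcingDet

/-- The determinant belongs to the `2 × 2` matrix with rows `α` and `β`, and `P`, `Q` are the
columns of its inverse. It also forces both minor rows to be nonzero: expanding it along `α` or `β`
provides the extra columns for the left inverses. -/
theorem nonempty_zeroForcing {H : XChannel 3 2 3}
    (hD : zeroForcingDet (H 0 0) (H 0 1) (H 0 2) ≠ 0) : Nonempty (ZeroForcing H) := by
  set h := H 0 0
  obtain ⟨D, hDdef⟩ : ∃ D, D = zeroForcingDet h (H 0 1) (H 0 2) := ⟨_, rfl⟩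
  rw [← hDdef] at hD
  have hi : D * D⁻¹ = 1 := mul_inv_cancel₀ hD
  obtain ⟨α, hα⟩ : ∃ α, α = minorRow (H 0 1) * h := ⟨_, rfl⟩
  obtain ⟨β, hβ⟩ : ∃ β, β = minorRow (H 0 2) * h := ⟨_, rfl⟩
  rw [zeroForcingDet, ← hα, ← hβ] at hDdef
  nth_rw 1 [hDdef] at hi
  have hαj : ∀ j, α 0 j = minorRow (H 0 1) 0 0 * h 0 j + minorRow (H 0 1) 0 1 * h 1 j +
      minorRow (H 0 1) 0 2 * h 2 j := fun j => by
    rw [hα, Matrix.mul_apply, Fin.sum_univ_three]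
  have hβj : ∀ j, β 0 j = minorRow (H 0 2) 0 0 * h 0 j + minorRow (H 0 2) 0 1 * h 1 j +
      minorRow (H 0 2) 0 2 * h 2 j := fun j => by
    rw [hβ, Matrix.mul_apply, Fin.sum_univ_three]
  obtain ⟨L₁, hL₁⟩ := exists_leftInverse_of_minorRow (H 0 1)
    (fun r => D⁻¹ * (β 0 1 * h r 0 - β 0 0 * h r 1)) (by
      linear_combination hi - D⁻¹ * β 0 1 * hαj 0 + D⁻¹ * β 0 0 * hαj 1)
  obtain ⟨L₂, hL₂⟩ := exists_leftInverse_of_minorRow (H 0 2)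
    (fun r => D⁻¹ * (α 0 0 * h r 1 - α 0 1 * h r 0)) (by
      linear_combination hi - D⁻¹ * α 0 0 * hβj 1 + D⁻¹ * α 0 1 * hβj 0)
  refine ⟨⟨minorRow (H 0 1), minorRow (H 0 2), D⁻¹ • !![β 0 1; -β 0 0], D⁻¹ • !![-α 0 1; α 0 0],
    L₁, L₂, minorRow_mul_self _, minorRow_mul_self _, ?_, hL₁, hL₂⟩⟩
  rw [← hα, ← hβ]
  ext i j
  fin_cases i <;> fin_cases j <;> simp [Matrix.vecMul, dotProduct] <;>
    first | ring1 | linear_combination hi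

/-- Induction by Fubini: for almost all values of the other variables the leading coefficient in the
first one is nonzero, which leaves finitely many roots, a null set for an atomless measure. -/
theorem measure_pi_eval_eq_zero {m : ℕ} (μ : Fin m → Measure ℂ) [∀ i, IsProbabilityMeasure (μ i)]
    [∀ i, NullSingletonClass (μ i)] (p : MvPolynomial (Fin m) ℂ) (hp : p ≠ 0) :
    Measure.pi μ {x | MvPolynomial.eval x p = 0} = 0 := by
  induction m with
  | zero =>
    have : {x : Fin 0 → ℂ | MvPolynomial.eval x p = 0} = ∅ := by
      refine Set.eq_empty_of_forall_notMem fun x hx => hp ?_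
      rw [MvPolynomial.eq_C_of_isEmpty p] at hx ⊢
      rw [Set.mem_ofPred_eq, MvPolynomial.eval_C] at hx
      rw [hx, map_zero]
    rw [this, measure_empty]
  | succ m ih =>
    set q := MvPolynomial.finSuccEquiv ℂ m p with hq
    have hq0 : q ≠ 0 := by simpa [hq] using hp
    have hae := ih (fun i => μ i.succ) q.leadingCoeff (Polynomial.leadingCoeff_ne_zero.2 hq0)
    have hmeas : Measurable fun x : Fin (m + 1) → ℂ => MvPolynomial.eval x p :=
      (MvPolynomial.continuous_eval p).measurable
    have hset : MeasurableSet {x : Fin (m + 1) → ℂ | MvPolynomial.eval x p = 0} :=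
      hmeas (measurableSet_singleton 0)
    have he := (measurePreserving_piFinSuccAbove μ 0).symm
    rw [← he.measure_preimage hset.nullMeasurableSet]
    rw [Measure.prod_apply_symm (he.measurable hset)]
    refine (lintegral_congr_ae ?_).trans lintegral_zero
    filter_upwards [measure_eq_zero_iff_ae_notMem.1 hae] with y hy
    have hqy : q.map (MvPolynomial.eval y) ≠ 0 := fun h => hy (by
      have := congrArg (fun r => r.coeff q.natDegree) h
      simpa [Polynomial.coeff_map] using this)
    refine measure_mono_null (fun x hx => ?_)
      ((q.map (MvPolynomial.eval y)).roots.toFinset.finite_toSet.measure_zero (μ 0))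
    have hx' : MvPolynomial.eval (Fin.cons x y : Fin (m + 1) → ℂ) p = 0 := by
      rw [← Fin.insertNth_zero']
      exact hx
    rw [MvPolynomial.eval_eq_eval_mv_eval'] at hx'
    simpa [hqy] using hx'

theorem IndepContinuous.ae_eval_ne_zero {Ω : Type*} [MeasurableSpace Ω] {P : Measure Ω}
    [IsProbabilityMeasure P] {K M N : ℕ} {H : Ω → XChannel K M N} (hH : IndepContinuous P H)
    (p : MvPolynomial (Fin K × Fin K × Fin N × Fin M) ℂ) (hp : p ≠ 0) :
    ∀ᵐ ω ∂P, MvPolynomial.eval (fun q => H ω q.1 q.2.1 q.2.2.1 q.2.2.2) p ≠ 0 := by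
  let e := Fintype.equivFin (Fin K × Fin K × Fin N × Fin M)
  let X : Fin (Fintype.card (Fin K × Fin K × Fin N × Fin M)) → Ω → ℂ := fun i ω =>
    H ω (e.symm i).1 (e.symm i).2.1 (e.symm i).2.2.1 (e.symm i).2.2.2
  have hX : ∀ i, Measurable (X i) := fun i => hH.measurable _ _ _ _
  have hind : iIndepFun X P := hH.indep.precomp e.symm.injective
  have hmap := (iIndepFun_iff_map_fun_eq_pi_map fun i => (hX i).aemeasurable).1 hind
  have hprob : ∀ i, IsProbabilityMeasure (P.map (X i)) := fun i =>
    Measure.isProbabilityMeasure_map (hX i).aemeasurable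
  have hatom : ∀ i, NullSingletonClass (P.map (X i)) := fun i => ⟨fun x => by
    rw [Measure.map_apply (hX i) (measurableSet_singleton x)]
    exact hH.continuous _ _ _ _ x⟩
  have h0 := measure_pi_eval_eq_zero (fun i => P.map (X i)) (MvPolynomial.rename e p)
    (by rwa [Ne, map_eq_zero_iff _ (MvPolynomial.rename_injective e e.injective)])
  have hset : MeasurableSet {x | MvPolynomial.eval x (MvPolynomial.rename e p) = 0} :=
    (MvPolynomial.continuous_eval _).measurable (measurableSet_singleton 0)
  rw [← hmap, Measure.map_apply (measurable_pi_lambda _ hX) hset] at h0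
  rw [ae_iff]
  convert h0 using 2
  ext ω
  simp only [not_not, Set.mem_ofPred_eq, Set.mem_preimage, MvPolynomial.eval_rename]
  simp [Function.comp_def]

theorem IndepContinuous.ae_nonempty_zeroForcing {Ω : Type*} [MeasurableSpace Ω] {P : Measure Ω}
    [IsProbabilityMeasure P] {H : Ω → XChannel 3 2 3} (hH : IndepContinuous P H) :
    ∀ᵐ ω ∂P, Nonempty (ZeroForcing (H ω)) := by
  let Y : Fin 3 → Matrix (Fin 3) (Fin 2) (MvPolynomial (Fin 3 × Fin 3 × Fin 3 × Fin 2) ℂ) :=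
    fun i => Matrix.of fun r a => MvPolynomial.X (0, i, r, a)
  have heval : ∀ x, MvPolynomial.eval x (zeroForcingDet (Y 0) (Y 1) (Y 2)) =
      zeroForcingDet (Matrix.of fun r a => x (0, 0, r, a)) (Matrix.of fun r a => x (0, 1, r, a))
        (Matrix.of fun r a => x (0, 2, r, a)) := fun x => by
    simp [zeroForcingDet, minorRow, Matrix.mul_apply, Fin.sum_univ_three, Y]
  have hne : zeroForcingDet (Y 0) (Y 1) (Y 2) ≠ 0 := fun h => by
    -- Here the nulling rows are the third and the first unit vector, which read off the two inputs
    -- of transmitter `0` separately; the determinant is `-1`.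
    let B : Fin 3 → Matrix (Fin 3) (Fin 2) ℂ :=
      ![!![1, 0; 0, 0; 0, 1], !![1, 0; 0, 1; 0, 0], !![0, 0; 1, 0; 0, 1]]
    have := heval fun q => B q.2.1 q.2.2.1 q.2.2.2
    rw [h, map_zero] at this
    simp [zeroForcingDet, minorRow, Matrix.mul_apply, Fin.sum_univ_three, B] at this
  filter_upwards [hH.ae_eval_ne_zero _ hne] with ω hω
  rw [heval] at hω
  exact nonempty_zeroForcing hω

end

theorem mainTheorem10 {Ω : Type*} [MeasurableSpace Ω] (P : MeasureTheory.Measure Ω)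
    [MeasureTheory.IsProbabilityMeasure P] (M N : ℕ) (hM : M = 2) (hN : N = 3)
    (H : Ω → XChannel 3 M N) (hH : IndepContinuous P H) :
    (∀ᵐ ω ∂P, symDoF (H ω) ≤ ENNReal.ofReal (2 * N / 12)) ∧
      (2 * N / 12 : ℝ) = 1 / 2 ∧ (1 / 2 : ℝ) = M * N / (3 * M + 2 * N) := by
  subst hM hN
  have hval : (2 * (3 : ℕ) / 12 : ℝ) = 1 / 2 := by norm_num
  refine ⟨?_, hval, by norm_num⟩
  filter_upwards [hH.ae_nonempty_zeroForcing] with ω ⟨Z⟩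
  rw [hval]
  exact Z.symDoF_le
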